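/- Let $d\ge 1$ be an integer and $d/2<\beta\le d$. Let $X=(X_t)_{t\ge0}$ and $X'=(X'_t)_{t\ge0}$ be independent copies of a nondegenerate symmetric stable process of order $\beta$ in $\mathbb{R}^d$ started at $0$, i.e. independent càdlàg Lévy processes with $E(e^{i\lambda\cdot X_t})=E(e^{i\lambda\cdot X'_t})=e^{-t\psi(\lambda)}$, where $\psi\ge 0$ is continuous, $\psi(r\lambda)=r^\beta\psi(\lambda)$ for $r\ge0$, $\psi(-\lambda)=\psi(\lambda)$, and $c|\lambda|^\beta\le\psi(\lambda)\le C|\lambda|^\beta$ for some constants $0<c<C<\infty$. Let $f\in\mathcal{S}(\mathbb{R}^d)$ be a nonnegative Schwartz function with $f(-x)=f(x)$ and $\int_{\mathbb{R}^d} f\,dx=1$, let $f_\varepsilon(x)=\varepsilon^{-d}f(x/\varepsilon)$, and for $t,\varepsilon>0$ set $$\alpha_{t,\varepsilon}=\int_0^t\int_0^t f_\varepsilon(X_s-X'_r)\,dr\,ds .$$ For $\rho>0$ and $\theta\in\mathbb{R}$ put $$M_\rho(\theta)=\sup_{\varepsilon,\varepsilon',t>0,\ \varepsilon\ne\varepsilon'}E\exp\left\{\theta\left|\frac{\alpha_{t,\varepsilon}-\alpha_{t,\varepsilon'}}{|\varepsilon-\varepsilon'|^{\rho}\,t^{2-(d+\rho)/\beta}}\right|^{\beta/(d+\rho)}\right\}\in[0,\infty].$$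 Then there is $\rho_0>0$ such that for every $\rho\in(0,\rho_0)$ there is some $\theta>0$ with $M_\rho(\theta)<\infty$, and moreover $\lim_{\theta\to0}M_\rho(\theta)=1$. -/

import Mathlib

open MeasureTheory ProbabilityTheory Filter Topology
open scoped NNReal ENNReal

/-- A path indexed by `[0, ∞)` is càdlàg: right continuous with left limits. -/
def IsCadlag {E : Type*} [TopologicalSpace E] (x : ℝ≥0 → E) : Prop :=
  ∀ t, ContinuousWithinAt x (Set.Ici t) t ∧ ∃ l, Tendsto x (𝓝[<] t) (𝓝 l)

/-- `ψ` has the form of the characteristic exponent of a nondegenerate symmetric (not necessarily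
rotation invariant) stable process of order `β` in `ℝ^d`. -/
structure IsSymmetricStableExponent {d : ℕ} (β : ℝ) (ψ : EuclideanSpace ℝ (Fin d) → ℝ) :
    Prop where
  nonneg : ∀ ξ, 0 ≤ ψ ξ
  continuous : Continuous ψ
  homogeneous : ∀ (r : ℝ) (ξ : EuclideanSpace ℝ (Fin d)), 0 ≤ r → ψ (r • ξ) = r ^ β * ψ ξ
  even : ∀ ξ, ψ (-ξ) = ψ ξ
  bounds : ∃ c C : ℝ, 0 < c ∧ c < C ∧ ∀ ξ, c * ‖ξ‖ ^ β ≤ ψ ξ ∧ ψ ξ ≤ C * ‖ξ‖ ^ β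

/-- `X` is a nondegenerate symmetric stable process of order `β` in `ℝ^d`, started at the origin,
with characteristic exponent `ψ`: a Lévy process with `E exp(i ξ · X_t) = exp(-t ψ(ξ))`. -/
structure IsSymmetricStableProcess {d : ℕ} {Ω : Type*} [MeasurableSpace Ω] (β : ℝ)
    (ψ : EuclideanSpace ℝ (Fin d) → ℝ) (X : ℝ≥0 → Ω → EuclideanSpace ℝ (Fin d))
    (P : Measure Ω) : Prop where
  exponent : IsSymmetricStableExponent β ψ
  measurable : ∀ t, Measurable (X t)
  start : ∀ᵐ ω ∂P, X 0 ω = 0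
  cadlag : ∀ᵐ ω ∂P, IsCadlag (fun t => X t ω)
  indep_increments : HasIndepIncrements X P
  stationary_increments : ∀ s t, s ≤ t →
    IdentDistrib (fun ω => X t ω - X s ω) (X (t - s)) P P
  charFun_eq : ∀ (t : ℝ≥0) (ξ : EuclideanSpace ℝ (Fin d)),
    charFun (P.map (X t)) ξ = Complex.exp (-((t : ℝ) * ψ ξ : ℝ))

/-- `f` is a nonnegative symmetric Schwartz function on `ℝ^d` with integral one. -/
structure IsMollifier {d : ℕ} (f : SchwartzMap (EuclideanSpace ℝ (Fin d)) ℝ) : Prop where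
  nonneg : ∀ x, 0 ≤ f x
  even : ∀ x, f (-x) = f x
  integral_eq_one : ∫ x, f x = 1

/-- The approximate delta function `f_ε(x) = ε^{-d} f(x / ε)`. -/
noncomputable def approxDelta {d : ℕ} (f : SchwartzMap (EuclideanSpace ℝ (Fin d)) ℝ) (ε : ℝ)
    (x : EuclideanSpace ℝ (Fin d)) : ℝ :=
  f (ε⁻¹ • x) / ε ^ d

/-- The mollified mutual intersection local time
`α_{t,ε} = ∫_0^t ∫_0^t f_ε(X_s - X'_r) dr ds`, as a random variable. -/
noncomputable def mutualILT {d : ℕ} {Ω : Type*} (f : SchwartzMap (EuclideanSpace ℝ (Fin d)) ℝ)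
    (X X' : ℝ≥0 → Ω → EuclideanSpace ℝ (Fin d)) (t ε : ℝ) (ω : Ω) : ℝ :=
  ∫ s in (0 : ℝ)..t, ∫ r in (0 : ℝ)..t, approxDelta f ε (X s.toNNReal ω - X' r.toNNReal ω)

/-- The supremum over `t > 0` and distinct `ε, ε' > 0` of
`E exp(θ |(α_{t,ε} - α_{t,ε'}) / (|ε - ε'|^ρ t^{2 - (d + ρ)/β})|^{β/(d + ρ)})`, in `[0, ∞]`. -/
noncomputable def supExpMoment {d : ℕ} {Ω : Type*} [MeasurableSpace Ω] (P : Measure Ω) (β : ℝ)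
    (f : SchwartzMap (EuclideanSpace ℝ (Fin d)) ℝ)
    (X X' : ℝ≥0 → Ω → EuclideanSpace ℝ (Fin d)) (ρ θ : ℝ) : ℝ≥0∞ :=
  ⨆ (ε : ℝ) (ε' : ℝ) (t : ℝ) (_ : 0 < ε ∧ 0 < ε' ∧ ε ≠ ε' ∧ 0 < t),
    ∫⁻ ω, ENNReal.ofReal (Real.exp (θ *
      |(mutualILT f X X' t ε ω - mutualILT f X X' t ε' ω) /
        (|ε - ε'| ^ ρ * t ^ (2 - (d + ρ) / β))| ^ (β / (d + ρ)))) ∂P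

/-! Everything rests on a bound for the even moments of D = α_{t,ε} - α_{t,ε'}, of the form E D^N ≤
(A |ε-ε'|^ρ t^{2-q} N^q)^N with q = (d+ρ)/β and A independent of N, t, ε, ε'.

Fourier inversion writes D as a superposition of characters of X_s - X'_r with amplitude g(ξ) =
h(εξ) - h(ε'ξ), and |g(ξ)| ≤ C(|ε-ε'||ξ|)^ρ (`exists_fourier_representation_approxDelta`). Expanding
D^N and using independence leaves the product of the joint characteristic functions of X and X'. For
ordered times, summation by parts turns each into a product over increments in which ψ is evaluated
at the suffix sums u_k of the frequencies. Integrating the times over [0,t]^N costs e^{lt} and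
leaves a sum over permutations of products of resolvents 1/(l + ψ(2πu_k))
(`IsSymmetricStableProcess.setLIntegral_enorm_integral_exp_le`).

The two processes give the square of this sum. Cauchy-Schwarz and the symmetry of the weight
∏|ξ_j|^ρ reduce it to (N!)² times the contribution of one permutation. Each ξ_j is a difference of
neighbouring suffix sums, so the weight is dominated by a product in the u_k and the integral
factorises (`exists_lintegral_symmetrized_resolvent_le`). One factor converges because 2β - 2ρ > d;
with a = l^{1/β} it is of order a^{d+ρ-2β}. The choice l = N/t gives the stated powers of t and N.

Since p = 1/q ≤ 2, such moments make E exp(θ|Z|^p) at most 4 at a fixed θ₀, where Z is the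
normalised difference (`lintegral_exp_mul_rpow_le`). Convexity of exp turns this into a bound 1 +
O(|θ|), uniform in all parameters, and e^x + e^{-x} ≥ 2 supplies the matching lower bound. -/

/-! ### Triangular changes of variables: time increments and frequency suffix sums -/

/-- The product of functions of successive increments integrates to the product of the
integrals. -/
theorem lintegral_prod_increments {n : ℕ} (h : Fin n → ℝ → ℝ≥0∞) (hh : ∀ k, Measurable (h k))
    (a : ℝ) :
    ∫⁻ s : Fin n → ℝ, ∏ k, h k (s k - (Fin.cons a s : Fin (n + 1) → ℝ) k.castSucc) =
      ∏ k, ∫⁻ x, h k x := by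
  -- Once the first time is fixed, it becomes the base point of the remaining increments, so the
  -- induction has to cover every base point.
  induction n generalizing a with
  | zero => simp [lintegral_unique, volume_pi]
  | succ n ih =>
    have hmp := (volume_preserving_piFinSuccAbove (fun _ : Fin (n + 1) => ℝ) 0).symm
    rw [← hmp.lintegral_comp_emb (MeasurableEquiv.measurableEmbedding _)]
    have hcons : ∀ (a : ℝ) (n : ℕ) (k : Fin (n + 1)),
        Measurable fun s : Fin n → ℝ => (Fin.cons a s : Fin (n + 1) → ℝ) k := by
      intro a n k
      refine Fin.cases ?_ (fun i => ?_) k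
      · simp
      · simpa using measurable_pi_apply i
    have hcons' : ∀ (n : ℕ) (k : Fin (n + 1)),
        Measurable fun z : ℝ × (Fin n → ℝ) => (Fin.cons z.1 z.2 : Fin (n + 1) → ℝ) k := by
      intro n k
      refine Fin.cases ?_ (fun i => ?_) k
      · simpa using measurable_fst
      · simpa using! (measurable_pi_apply i).comp measurable_snd
    have key : ∀ z : ℝ × (Fin n → ℝ),
        ∏ k, h k (((MeasurableEquiv.piFinSuccAbove (fun _ : Fin (n + 1) => ℝ) 0).symm z) k -
          (Fin.cons a ((MeasurableEquiv.piFinSuccAbove (fun _ : Fin (n + 1) => ℝ) 0).symm z) :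
            Fin (n + 2) → ℝ) k.castSucc) =
        h 0 (z.1 - a) * ∏ k : Fin n, h k.succ (z.2 k - (Fin.cons z.1 z.2 :
          Fin (n + 1) → ℝ) k.castSucc) := by
      intro z
      rw [Fin.prod_univ_succ]
      simp only [MeasurableEquiv.piFinSuccAbove_symm_apply, Fin.insertNthEquiv_zero,
        Fin.consEquiv_apply, Fin.castSucc_zero, Fin.cons_zero, Fin.cons_succ, Fin.castSucc_succ]
    simp_rw [key]
    rw [Measure.volume_eq_prod, lintegral_prod _ (by
      refine Measurable.aemeasurable ?_
      refine ((hh 0).comp (measurable_fst.sub_const a)).mul ?_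
      refine Finset.measurable_prod _ fun k _ => (hh _).comp ?_
      exact ((measurable_pi_apply k).comp measurable_snd).sub (hcons' n _))]
    have inner : ∀ x : ℝ, ∫⁻ y : Fin n → ℝ, h 0 (x - a) *
        ∏ k : Fin n, h k.succ (y k - (Fin.cons x y : Fin (n + 1) → ℝ) k.castSucc) =
        h 0 (x - a) * ∏ k : Fin n, ∫⁻ x, h k.succ x := by
      intro x
      rw [lintegral_const_mul]
      · rw [ih _ (fun k => hh _) x]
      · refine Finset.measurable_prod _ fun k _ => (hh _).comp ?_
        exact (measurable_pi_apply k).sub (hcons x n _)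
    simp_rw [inner]
    have h0 : Measurable fun x => h 0 (x - a) := (hh 0).comp (measurable_id.sub_const a)
    rw [lintegral_mul_const _ h0,
      lintegral_sub_right_eq_self (h 0) a, Fin.prod_univ_succ]

/-- The sum of the entries of `ξ` from index `k` on. -/
def suffixSum {E : Type*} [AddCommMonoid E] {n : ℕ} (ξ : Fin n → E) (k : Fin n) : E :=
  ∑ j ∈ Finset.Ici k, ξ j

theorem measurable_suffixSum {E : Type*} [AddCommMonoid E] [MeasurableSpace E] [MeasurableAdd₂ E]
    {n : ℕ} (k : Fin n) : Measurable fun ξ : Fin n → E => suffixSum ξ k :=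
  Finset.measurable_sum _ fun j _ => measurable_pi_apply j

theorem suffixSum_cons_succ {E : Type*} [AddCommMonoid E] {n : ℕ} (x : E) (ξ : Fin n → E)
    (k : Fin n) : suffixSum (Fin.cons x ξ : Fin (n + 1) → E) k.succ = suffixSum ξ k := by
  unfold suffixSum
  rw [← Fin.map_succEmb_Ici, Finset.sum_map]
  simp

theorem suffixSum_cons_zero {E : Type*} [AddCommMonoid E] {n : ℕ} (x : E) (ξ : Fin n → E) :
    suffixSum (Fin.cons x ξ : Fin (n + 1) → E) 0 = x + ∑ j, ξ j := by
  unfold suffixSum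
  have : (Finset.Ici (0 : Fin (n + 1))) = Finset.univ := by ext; simp
  rw [this, Fin.sum_univ_succ]
  simp

/-- The passage to suffix sums is triangular with unit diagonal: the first entry occurs only in the
first suffix sum, where translation invariance removes the other entries. -/
theorem lintegral_prod_suffixSum {E : Type*} [AddCommGroup E] [MeasureSpace E]
    [MeasurableAdd₂ E] [SigmaFinite (volume : Measure E)]
    [(volume : Measure E).IsAddRightInvariant] (n : ℕ) (q : E → ℝ≥0∞) (hq : Measurable q) :
    ∫⁻ ξ : Fin n → E, ∏ k, q (suffixSum ξ k) = (∫⁻ u, q u) ^ n := by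
  induction n with
  | zero => simp [lintegral_unique, volume_pi]
  | succ n ih =>
    have hmp := (volume_preserving_piFinSuccAbove (fun _ : Fin (n + 1) => E) 0).symm
    rw [← hmp.lintegral_comp_emb (MeasurableEquiv.measurableEmbedding _)]
    have key : ∀ z : E × (Fin n → E),
        ∏ k, q (suffixSum ((MeasurableEquiv.piFinSuccAbove (fun _ : Fin (n + 1) => E) 0).symm z) k)
          = q (z.1 + ∑ j, z.2 j) * ∏ k, q (suffixSum z.2 k) := by
      intro z
      rw [Fin.prod_univ_succ]
      simp only [MeasurableEquiv.piFinSuccAbove_symm_apply, Fin.insertNthEquiv_zero,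
        Fin.consEquiv, Equiv.coe_fn_mk, suffixSum_cons_succ, suffixSum_cons_zero]
    simp_rw [key]
    have hP : Measurable fun y : Fin n → E => ∏ k, q (suffixSum y k) :=
      Finset.measurable_prod _ fun k _ => hq.comp (measurable_suffixSum k)
    rw [Measure.volume_eq_prod, lintegral_prod_symm _ (by
      refine Measurable.aemeasurable ?_
      refine (hq.comp (measurable_fst.add ?_)).mul (hP.comp measurable_snd)
      exact Finset.measurable_sum _ fun j _ => (measurable_pi_apply j).comp measurable_snd)]
    have inner : ∀ y : Fin n → E, ∫⁻ x : E, q (x + ∑ j, y j) * ∏ k, q (suffixSum y k) =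
        (∫⁻ u, q u) * ∏ k, q (suffixSum y k) := by
      intro y
      have h0 : Measurable fun x => q (x + ∑ j, y j) := hq.comp (measurable_id.add_const _)
      rw [lintegral_mul_const _ h0,
        lintegral_add_right_eq_self]
    simp_rw [inner]
    rw [lintegral_const_mul _ hP, ih, pow_succ']

theorem sum_increments {n : ℕ} (a : ℝ) (s : Fin n → ℝ) :
    ∑ k : Fin n, (s k - (Fin.cons a s : Fin (n + 1) → ℝ) k.castSucc) =
      (Fin.cons a s : Fin (n + 1) → ℝ) (Fin.last n) - a := by
  have h1 := Fin.sum_univ_succ (Fin.cons a s : Fin (n + 1) → ℝ)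
  have h2 := Fin.sum_univ_castSucc (Fin.cons a s : Fin (n + 1) → ℝ)
  simp only [Fin.cons_zero, Fin.cons_succ] at h1
  rw [Finset.sum_sub_distrib]
  linarith

theorem lintegral_exp_neg_mul_Ici {b : ℝ} (hb : 0 < b) :
    ∫⁻ x, (Set.Ici (0 : ℝ)).indicator (fun x => ENNReal.ofReal (Real.exp (-(b * x)))) x =
      ENNReal.ofReal (1 / b) := by
  rw [lintegral_indicator measurableSet_Ici, setLIntegral_congr Ioi_ae_eq_Ici.symm,
    ← ofReal_integral_eq_lintegral_ofReal]
  · congr 1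
    have := integral_exp_mul_Ioi (a := -b) (by linarith) 0
    simpa [neg_mul] using this
  · simpa [neg_mul, IntegrableOn] using exp_neg_integrableOn_Ioi 0 hb
  · exact Eventually.of_forall fun x => (Real.exp_pos _).le

/-- Integrating over ordered times in `[0, t]` is controlled by the resolvent at `l`. -/
theorem setLIntegral_monotone_exp_le {n : ℕ} (b : Fin n → ℝ) (hb : ∀ k, 0 ≤ b k) {l t : ℝ}
    (hl : 0 < l) (ht : 0 ≤ t) :
    ∫⁻ s in {s : Fin n → ℝ | Monotone s ∧ ∀ k, s k ∈ Set.Icc 0 t},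
      ENNReal.ofReal (Real.exp
        (-∑ k, (s k - (Fin.cons 0 s : Fin (n + 1) → ℝ) k.castSucc) * b k)) ≤
      ENNReal.ofReal (Real.exp (l * t)) * ∏ k, ENNReal.ofReal (1 / (l + b k)) := by
  -- Adding `l` to every rate telescopes to the factor exp(-l · last time), which is at least exp(-l
  -- t) on the domain. The half-line indicators equal 1 at ordered times and let the integral be
  -- extended to the whole space.
  set h : Fin n → ℝ → ℝ≥0∞ := fun k =>
    (Set.Ici (0 : ℝ)).indicator fun x => ENNReal.ofReal (Real.exp (-((l + b k) * x)))
  have hh : ∀ k, Measurable (h k) := fun k =>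
    Measurable.indicator (by fun_prop) measurableSet_Ici
  have hprod := lintegral_prod_increments h hh 0
  have hint : ∀ k, ∫⁻ x, h k x = ENNReal.ofReal (1 / (l + b k)) := fun k =>
    lintegral_exp_neg_mul_Ici (by linarith [hb k])
  simp_rw [hint] at hprod
  rw [← hprod, ← lintegral_const_mul' _ _ ENNReal.ofReal_ne_top]
  refine (lintegral_mono_ae ?_).trans (setLIntegral_le_lintegral
    {s : Fin n → ℝ | Monotone s ∧ ∀ k, s k ∈ Set.Icc 0 t} _)
  have hclosed : IsClosed {s : Fin n → ℝ | Monotone s ∧ ∀ k, s k ∈ Set.Icc 0 t} := by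
    refine IsClosed.inter isClosed_monotone ?_
    have : {s : Fin n → ℝ | ∀ k, s k ∈ Set.Icc 0 t} = ⋂ k, {s | s k ∈ Set.Icc 0 t} := by
      ext; simp
    change IsClosed {s : Fin n → ℝ | ∀ k, s k ∈ Set.Icc 0 t}
    exact this ▸ isClosed_iInter fun k => isClosed_Icc.preimage (continuous_apply k)
  refine (ae_restrict_iff' hclosed.measurableSet).2 (Eventually.of_forall ?_)
  rintro s ⟨hmono, hs⟩
  have hinc : ∀ k : Fin n, 0 ≤ s k - (Fin.cons 0 s : Fin (n + 1) → ℝ) k.castSucc := by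
    intro k
    have : Monotone (Fin.cons 0 s : Fin (n + 1) → ℝ) := by
      cases n with
      | zero => exact fun i j _ => by rw [Subsingleton.elim (α := Fin 1) i j]
      | succ m =>
        refine Fin.monotone_iff_le_succ.2 fun i => ?_
        refine Fin.cases ?_ (fun j => ?_) i
        · simpa using (hs 0).1
        · rw [← Fin.succ_castSucc]
          simpa using hmono (Fin.castSucc_le_succ j)
    have := this (Fin.castSucc_le_succ k)
    simpa using this
  have hlast : (Fin.cons 0 s : Fin (n + 1) → ℝ) (Fin.last n) ≤ t := by
    refine Fin.cases ?_ (fun j => ?_) (Fin.last n)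
    · simpa using ht
    · simpa using (hs j).2
  have hval : ∀ k, h k (s k - (Fin.cons 0 s : Fin (n + 1) → ℝ) k.castSucc) =
      ENNReal.ofReal (Real.exp (-((l + b k) *
        (s k - (Fin.cons 0 s : Fin (n + 1) → ℝ) k.castSucc)))) := fun k =>
    Set.indicator_of_mem (hinc k) _
  simp_rw [hval]
  rw [← ENNReal.ofReal_prod_of_nonneg fun _ _ => (Real.exp_pos _).le,
    ← ENNReal.ofReal_mul (Real.exp_pos _).le, ← Real.exp_sum, ← Real.exp_add]
  refine ENNReal.ofReal_le_ofReal (Real.exp_le_exp.2 ?_)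
  have h1 := sum_increments 0 s
  have h2 : ∑ k, -((l + b k) * (s k - (Fin.cons 0 s : Fin (n + 1) → ℝ) k.castSucc)) =
      -(l * ∑ k, (s k - (Fin.cons 0 s : Fin (n + 1) → ℝ) k.castSucc)) -
      ∑ k, (s k - (Fin.cons 0 s : Fin (n + 1) → ℝ) k.castSucc) * b k := by
    rw [Finset.mul_sum, ← Finset.sum_neg_distrib, ← Finset.sum_sub_distrib]
    exact Finset.sum_congr rfl fun k _ => by ring
  rw [h2, h1]
  nlinarith

/-- Summation by parts: the increment at index k is shared by every later position, hence is paired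
with the sum of all frequencies from k on. -/
theorem sum_inner_sub_eq_sum_inner_suffixSum {E : Type*} [NormedAddCommGroup E]
    [InnerProductSpace ℝ E] {n : ℕ} (a : E) (x ξ : Fin n → E) :
    ∑ j, inner ℝ (x j - a) (ξ j) =
      ∑ k, inner ℝ (x k - (Fin.cons a x : Fin (n + 1) → E) k.castSucc) (suffixSum ξ k) := by
  induction n generalizing a with
  | zero => simp
  | succ n ih =>
    obtain ⟨y, x', rfl⟩ : ∃ y x', x = Fin.cons y x' := ⟨x 0, Fin.tail x, (Fin.cons_self_tail x).symm⟩
    obtain ⟨η, ξ', rfl⟩ : ∃ y x', ξ = Fin.cons y x' := ⟨ξ 0, Fin.tail ξ, (Fin.cons_self_tail ξ).symm⟩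
    simp only [Fin.sum_univ_succ, Fin.cons_zero, Fin.cons_succ, Fin.castSucc_zero,
      Fin.castSucc_succ, suffixSum_cons_succ, suffixSum_cons_zero]
    rw [← ih, inner_add_right, inner_sum, add_assoc, ← Finset.sum_add_distrib]
    congr 1
    refine Finset.sum_congr rfl fun j _ => ?_
    rw [← inner_add_left]
    congr 1
    abel

theorem monotone_cons_bot {α : Type*} [Preorder α] [OrderBot α] {n : ℕ} {s : Fin n → α}
    (hs : Monotone s) : Monotone (Fin.cons ⊥ s : Fin (n + 1) → α) := by
  intro i j
  refine Fin.cases (fun _ => by simp) (fun i => ?_) i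
  refine Fin.cases (fun h => ?_) (fun j h => ?_) j
  · simp at h
  · simpa using hs (Fin.succ_le_succ_iff.1 h)

/-! ### Joint characteristic functions of the process and their time integrals -/

section

variable {d : ℕ} {Ω : Type*} [MeasurableSpace Ω] {β : ℝ}
    {ψ : EuclideanSpace ℝ (Fin d) → ℝ} {X : ℝ≥0 → Ω → EuclideanSpace ℝ (Fin d)}
    {P : Measure Ω}

theorem IsSymmetricStableProcess.integral_exp_increment
    (hX : IsSymmetricStableProcess β ψ X P) {s t : ℝ≥0} (hst : s ≤ t)
    (ξ : EuclideanSpace ℝ (Fin d)) :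
    ∫ ω, Complex.exp ((inner ℝ (X t ω - X s ω) ξ : ℝ) * Complex.I) ∂P =
      Complex.exp (-(((t : ℝ) - s) * ψ ξ : ℝ)) := by
  have h1 := hX.charFun_eq (t - s) ξ
  have hm : Measurable fun ω => X t ω - X s ω := (hX.measurable t).sub (hX.measurable s)
  rw [← (hX.stationary_increments s t hst).map_eq, charFun_apply, integral_map
    hm.aemeasurable (by fun_prop), NNReal.coe_sub hst] at h1
  exact h1

/-- The joint characteristic function of the process at ordered times. -/
theorem IsSymmetricStableProcess.integral_exp_sum [IsProbabilityMeasure P]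
    (hX : IsSymmetricStableProcess β ψ X P) {n : ℕ} {s : Fin n → ℝ≥0} (hs : Monotone s)
    (ξ : Fin n → EuclideanSpace ℝ (Fin d)) :
    ∫ ω, Complex.exp ((∑ j, inner ℝ (X (s j) ω) (ξ j) : ℝ) * Complex.I) ∂P =
      Complex.exp (-(∑ k, ((s k : ℝ) - (Fin.cons 0 s : Fin (n + 1) → ℝ≥0) k.castSucc) *
        ψ (suffixSum ξ k) : ℝ)) := by
  -- Prepending time 0, where the process vanishes almost surely, makes all values sums of
  -- independent increments.
  set τ : Fin (n + 1) → ℝ≥0 := Fin.cons 0 s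
  have hτ : Monotone τ := monotone_cons_bot hs
  have hae : ∀ᵐ ω ∂P, Complex.exp ((∑ j, inner ℝ (X (s j) ω) (ξ j) : ℝ) * Complex.I) =
      ∏ k, Complex.exp ((inner ℝ (X (τ k.succ) ω - X (τ k.castSucc) ω) (suffixSum ξ k) : ℝ) *
        Complex.I) := by
    filter_upwards [hX.start] with ω hω
    have h := sum_inner_sub_eq_sum_inner_suffixSum 0 (fun j => X (s j) ω) ξ
    simp only [sub_zero] at h
    rw [← Complex.exp_sum, ← Finset.sum_mul, h]
    push_cast
    congr 3
    ext k
    congr 3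
    refine Fin.cases ?_ (fun j => ?_) k.castSucc
    · simp [τ, hω]
    · simp [τ]
  rw [integral_congr_ae hae]
  have hind := hX.indep_increments n τ hτ
  have hprod := hind.integral_fun_prod_comp
    (f := fun k x => Complex.exp ((inner ℝ x (suffixSum ξ k) : ℝ) * Complex.I))
    (fun k => ((hX.measurable _).sub (hX.measurable _)).aemeasurable)
    (fun k => Continuous.aestronglyMeasurable (by fun_prop))
  rw [hprod]
  have hk : ∀ k : Fin n, ∫ ω, Complex.exp
      ((inner ℝ (X (τ k.succ) ω - X (τ k.castSucc) ω) (suffixSum ξ k) : ℝ) * Complex.I) ∂P =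
      Complex.exp (-(((s k : ℝ) - τ k.castSucc) * ψ (suffixSum ξ k) : ℝ)) := fun k => by
    rw [hX.integral_exp_increment (hτ (Fin.castSucc_le_succ k))]
    simp [τ]
  simp_rw [hk]
  rw [← Complex.exp_sum]
  push_cast
  rw [Finset.sum_neg_distrib]

/-- The resolvent bound for the time integral of the joint characteristic function. -/
theorem IsSymmetricStableProcess.setLIntegral_enorm_integral_exp_le [IsProbabilityMeasure P]
    (hX : IsSymmetricStableProcess β ψ X P) {n : ℕ}
    (ξ : Fin n → EuclideanSpace ℝ (Fin d)) {l t : ℝ} (hl : 0 < l) (ht : 0 ≤ t) :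
    ∫⁻ s in {s : Fin n → ℝ | ∀ k, s k ∈ Set.Icc 0 t},
      ‖∫ ω, Complex.exp ((∑ j, inner ℝ (X (s j).toNNReal ω) (ξ j) : ℝ) * Complex.I) ∂P‖ₑ ≤
    ENNReal.ofReal (Real.exp (l * t)) * ∑ π : Equiv.Perm (Fin n),
      ∏ k, ENNReal.ofReal (1 / (l + ψ (suffixSum (ξ ∘ π) k))) := by
  set A : Set (Fin n → ℝ) := {s | ∀ k, s k ∈ Set.Icc 0 t}
  set B : Set (Fin n → ℝ) := {s | Monotone s ∧ ∀ k, s k ∈ Set.Icc 0 t}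
  set R : (Fin n → EuclideanSpace ℝ (Fin d)) → (Fin n → ℝ) → ℝ≥0∞ := fun η s =>
    ENNReal.ofReal (Real.exp (-∑ k, (s k - (Fin.cons 0 s : Fin (n + 1) → ℝ) k.castSucc) *
      ψ (suffixSum η k)))
  have hA : IsClosed A := by
    have : A = ⋂ k, {s | s k ∈ Set.Icc 0 t} := by ext; simp [A]
    exact this ▸ isClosed_iInter fun k => isClosed_Icc.preimage (continuous_apply k)
  have hB : IsClosed B := isClosed_monotone.inter hA
  have hRmeas : ∀ η, Measurable (R η) := by
    intro η
    have hcons : ∀ k : Fin (n + 1),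
        Measurable fun s : Fin n → ℝ => (Fin.cons 0 s : Fin (n + 1) → ℝ) k := by
      intro k
      refine Fin.cases ?_ (fun i => ?_) k
      · simp
      · simpa using measurable_pi_apply i
    refine ENNReal.measurable_ofReal.comp (Real.measurable_exp.comp (Measurable.neg ?_))
    exact Finset.measurable_sum _ fun k _ =>
      ((measurable_pi_apply k).sub (hcons _)).mul_const _
  have hpt : ∀ s ∈ A,
      ‖∫ ω, Complex.exp ((∑ j, inner ℝ (X (s j).toNNReal ω) (ξ j) : ℝ) * Complex.I) ∂P‖ₑ ≤
        ∑ π : Equiv.Perm (Fin n), B.indicator (R (ξ ∘ π)) (s ∘ π) := by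
    intro s hs
    -- Arbitrary times are sorted, and the term of the sorting permutation already equals the left
    -- side. The other terms are nonnegative, so ties between times do no harm.
    set σ := Tuple.sort s
    have hmono : Monotone (s ∘ σ) := Tuple.monotone_sort s
    have hmem : s ∘ σ ∈ B := ⟨hmono, fun k => hs _⟩
    refine le_trans (le_of_eq ?_) (Finset.single_le_sum (fun _ _ => zero_le)
      (Finset.mem_univ σ))
    rw [Set.indicator_of_mem hmem]
    have hmono' : Monotone fun j => (s (σ j)).toNNReal := fun i j hij =>
      Real.toNNReal_mono (hmono hij)
    have hreorder : ∀ ω, ∑ j, inner ℝ (X (s j).toNNReal ω) (ξ j) =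
        ∑ j, inner ℝ (X (s (σ j)).toNNReal ω) ((ξ ∘ σ) j) := fun ω =>
      (Equiv.sum_comp σ fun j => inner ℝ (X (s j).toNNReal ω) (ξ j)).symm
    simp_rw [hreorder]
    rw [hX.integral_exp_sum hmono' (ξ ∘ σ), ← Complex.ofReal_neg, ← Complex.ofReal_exp,
      ← ofReal_norm, Complex.norm_real, Real.norm_of_nonneg (Real.exp_pos _).le]
    simp only [R]
    congr 4
    ext k
    congr 2
    · exact Real.coe_toNNReal _ (hs _).1
    · refine Fin.cases (by simp) (fun j => ?_) k.castSucc
      simpa using (hs _).1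
  calc _ ≤ ∫⁻ s in A, ∑ π : Equiv.Perm (Fin n), B.indicator (R (ξ ∘ π)) (s ∘ π) :=
        lintegral_mono_ae ((ae_restrict_iff' hA.measurableSet).2 (Eventually.of_forall hpt))
    _ ≤ ∫⁻ s, ∑ π : Equiv.Perm (Fin n), B.indicator (R (ξ ∘ π)) (s ∘ π) :=
        setLIntegral_le_lintegral _ _
    _ = ∑ π : Equiv.Perm (Fin n), ∫⁻ s, B.indicator (R (ξ ∘ π)) (s ∘ π) := by
        refine lintegral_finsetSum _ fun π _ => ?_
        refine ((hRmeas _).indicator hB.measurableSet).comp ?_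
        exact measurable_pi_lambda _ fun k => measurable_pi_apply _
    _ = ∑ π : Equiv.Perm (Fin n), ∫⁻ s in B, R (ξ ∘ π) s := by
        refine Finset.sum_congr rfl fun π _ => ?_
        rw [← lintegral_indicator hB.measurableSet]
        have hmp := volume_measurePreserving_piCongrLeft (fun _ : Fin n => ℝ) π.symm
        rw [← hmp.lintegral_comp_emb (MeasurableEquiv.measurableEmbedding _)
          (B.indicator (R (ξ ∘ π)))]
        refine lintegral_congr fun s => ?_
        congr 1
        ext k
        have := MeasurableEquiv.piCongrLeft_apply_apply (β := fun _ : Fin n => ℝ) π.symm s (π k)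
        simpa using this.symm
    _ ≤ _ := by
        rw [Finset.mul_sum]
        exact Finset.sum_le_sum fun π _ =>
          setLIntegral_monotone_exp_le _ (fun k => hX.exponent.nonneg _) hl ht

end

/-! ### The weighted L² estimate in frequency space -/

theorem ENNReal.sq_sum_le_card_mul_sum_sq {ι : Type*} (s : Finset ι) (f : ι → ℝ≥0∞) :
    (∑ i ∈ s, f i) ^ 2 ≤ s.card * ∑ i ∈ s, f i ^ 2 := by
  have h := ENNReal.rpow_sum_le_const_mul_sum_rpow s f (p := 2) (by norm_num)
  norm_num at h
  exact h

/-- Each entry is a difference of suffix sums, so the product of the norms of the entries is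
controlled by the suffix sums. -/
theorem prod_norm_le_prod_suffixSum {E : Type*} [NormedAddCommGroup E] {n : ℕ} {a : ℝ}
    (ha : 0 < a) (ξ : Fin n → E) :
    ∏ j, ‖ξ j‖ ≤ ∏ k, ((a + ‖suffixSum ξ k‖) ^ 2 / a) := by
  -- The extra factor on the left belongs to the leading suffix sum and is what the induction needs:
  -- a suffix sum enters two consecutive differences, which accounts for the square. The final
  -- differences end at the empty sum, whence the factor `a`.
  have key : (a + ‖∑ j, ξ j‖) * ∏ j, ‖ξ j‖ ≤ a * ∏ k, ((a + ‖suffixSum ξ k‖) ^ 2 / a) := by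
    induction n with
    | zero => simp
    | succ n ih =>
      obtain ⟨x, ξ', rfl⟩ : ∃ y x', ξ = Fin.cons y x' :=
        ⟨ξ 0, Fin.tail ξ, (Fin.cons_self_tail ξ).symm⟩
      simp only [Fin.sum_univ_succ, Fin.prod_univ_succ, Fin.cons_zero, Fin.cons_succ,
        suffixSum_cons_succ, suffixSum_cons_zero]
      have ih := ih ξ'
      set U := ∑ j, ξ' j
      set Q := ∏ j, ‖ξ' j‖
      have hQ : 0 ≤ Q := Finset.prod_nonneg fun _ _ => norm_nonneg _
      have hx : ‖x‖ ≤ ‖x + U‖ + ‖U‖ := by simpa using norm_sub_le (x + U) U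
      have hx' : ‖x‖ ≤ (a + ‖x + U‖) / a * (a + ‖U‖) := by
        rw [div_mul_eq_mul_div, le_div_iff₀ ha]
        nlinarith [mul_nonneg (norm_nonneg (x + U)) (norm_nonneg U)]
      calc (a + ‖x + U‖) * (‖x‖ * Q)
          ≤ (a + ‖x + U‖) * (((a + ‖x + U‖) / a * (a + ‖U‖)) * Q) := by gcongr
        _ = (a + ‖x + U‖) ^ 2 / a * ((a + ‖U‖) * Q) := by ring
        _ ≤ (a + ‖x + U‖) ^ 2 / a * (a * ∏ k, ((a + ‖suffixSum ξ' k‖) ^ 2 / a)) := by gcongr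
        _ = _ := by rw [mul_left_comm]
  have hQ : 0 ≤ ∏ j, ‖ξ j‖ := Finset.prod_nonneg fun _ _ => norm_nonneg _
  refine le_of_mul_le_mul_left (le_trans ?_ key) ha
  nlinarith [mul_nonneg (norm_nonneg (∑ j, ξ j)) hQ]

theorem add_rpow_le_two_rpow_mul {a x β : ℝ} (ha : 0 ≤ a) (hx : 0 ≤ x) (hβ : 0 ≤ β) :
    (a + x) ^ β ≤ 2 ^ β * (a ^ β + x ^ β) := by
  have h1 : a + x ≤ 2 * max a x := by linarith [le_max_left a x, le_max_right a x]
  have h2 : 0 ≤ max a x := ha.trans (le_max_left _ _)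
  calc (a + x) ^ β ≤ (2 * max a x) ^ β := by gcongr
    _ = 2 ^ β * max a x ^ β := Real.mul_rpow (by norm_num) h2
    _ ≤ _ := by
      gcongr
      rcases max_cases a x with ⟨h, _⟩ | ⟨h, _⟩ <;> rw [h]
      · linarith [Real.rpow_nonneg hx β]
      · linarith [Real.rpow_nonneg ha β]

/-- Scaling u = a v; the condition on `r` makes the remaining integral converge. -/
theorem lintegral_add_norm_rpow {d : ℕ} {a r : ℝ} (ha : 0 < a) (hr : (d : ℝ) < r) :
    ∫⁻ u : EuclideanSpace ℝ (Fin d), ENNReal.ofReal ((a + ‖u‖) ^ (-r)) =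
      ENNReal.ofReal (a ^ (d - r) * ∫ u : EuclideanSpace ℝ (Fin d), (1 + ‖u‖) ^ (-r)) := by
  have hint : Integrable fun u : EuclideanSpace ℝ (Fin d) => (1 + ‖u‖) ^ (-r) :=
    integrable_one_add_norm (by simpa using hr)
  have heq : ∀ u : EuclideanSpace ℝ (Fin d),
      (a + ‖u‖) ^ (-r) = a ^ (-r) * (1 + ‖a⁻¹ • u‖) ^ (-r) := by
    intro u
    rw [← Real.mul_rpow ha.le (by positivity), norm_smul, norm_inv, Real.norm_of_nonneg ha.le]
    congr 1
    field_simp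
  have hint' : Integrable fun u : EuclideanSpace ℝ (Fin d) => (a + ‖u‖) ^ (-r) := by
    simp_rw [heq]
    exact (hint.comp_smul (inv_ne_zero ha.ne')).const_mul _
  rw [← ofReal_integral_eq_lintegral_ofReal hint' (Eventually.of_forall fun u => by positivity)]
  congr 1
  simp_rw [heq]
  rw [integral_const_mul, Measure.integral_comp_inv_smul volume
    (fun u : EuclideanSpace ℝ (Fin d) => (1 + ‖u‖) ^ (-r))]
  rw [finrank_euclideanSpace_fin, abs_of_pos (by positivity), smul_eq_mul, ← mul_assoc,
    ← Real.rpow_natCast, ← Real.rpow_add ha]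
  ring_nf

/-- The weighted `L²` bound for the symmetrized product of resolvents. -/
theorem exists_lintegral_symmetrized_resolvent_le {d : ℕ} {β ρ c : ℝ} (hβ : 0 < β) (hρ : 0 ≤ ρ)
    (hdβ : (d : ℝ) + 2 * ρ < 2 * β) (hc : 0 < c) {κ : EuclideanSpace ℝ (Fin d) → ℝ}
    (hκm : Measurable κ) (hκ : ∀ u, c * ‖u‖ ^ β ≤ κ u) :
    ∃ K : ℝ, 0 ≤ K ∧ ∀ (n : ℕ) (a : ℝ), 0 < a →
      ∫⁻ ξ : Fin n → EuclideanSpace ℝ (Fin d), (∏ j, ENNReal.ofReal (‖ξ j‖ ^ ρ)) *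
        (∑ π : Equiv.Perm (Fin n),
          ∏ k, ENNReal.ofReal (1 / (a ^ β + κ (suffixSum (ξ ∘ π) k)))) ^ 2 ≤
      ENNReal.ofReal ((n.factorial : ℝ) ^ 2 * (K * a ^ (d + ρ - 2 * β)) ^ n) := by
  -- Chosen so that a^β + κ(u) ≥ c'(a + ‖u‖)^β, which puts resolvent and weight on the same scale.
  set c' : ℝ := min 1 c / 2 ^ β
  have hc' : 0 < c' := by positivity
  set I : ℝ := ∫ u : EuclideanSpace ℝ (Fin d), (1 + ‖u‖) ^ (-(2 * β - 2 * ρ))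
  have hI : 0 ≤ I := integral_nonneg fun u => by positivity
  refine ⟨(1 / c') ^ 2 * I, by positivity, fun n a ha => ?_⟩
  have hlow : ∀ u, c' * (a + ‖u‖) ^ β ≤ a ^ β + κ u := by
    intro u
    have h1 := add_rpow_le_two_rpow_mul ha.le (norm_nonneg u) hβ.le
    have h2 : 0 ≤ a ^ β := by positivity
    have h3 : 0 ≤ ‖u‖ ^ β := by positivity
    have h4 : min 1 c * (a ^ β + ‖u‖ ^ β) ≤ a ^ β + c * ‖u‖ ^ β := by
      nlinarith [mul_le_mul_of_nonneg_right (min_le_left 1 c) h2,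
        mul_le_mul_of_nonneg_right (min_le_right 1 c) h3]
    have h5 : c' * (a + ‖u‖) ^ β ≤ min 1 c * (a ^ β + ‖u‖ ^ β) := by
      rw [div_mul_eq_mul_div, div_le_iff₀ (by positivity)]
      calc min 1 c * (a + ‖u‖) ^ β ≤ min 1 c * (2 ^ β * (a ^ β + ‖u‖ ^ β)) := by gcongr
        _ = _ := by ring
    linarith [hκ u]
  set G : (Fin n → EuclideanSpace ℝ (Fin d)) → ℝ≥0∞ := fun ξ =>
    ∏ k, ENNReal.ofReal (1 / (a ^ β + κ (suffixSum ξ k)))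
  set w : (Fin n → EuclideanSpace ℝ (Fin d)) → ℝ≥0∞ := fun ξ =>
    ∏ j, ENNReal.ofReal (‖ξ j‖ ^ ρ)
  have hGm : Measurable G := Finset.measurable_prod _ fun k _ =>
    ENNReal.measurable_ofReal.comp
      (((hκm.comp (measurable_suffixSum k)).const_add _).const_div _)
  have hwm : Measurable w := Finset.measurable_prod _ fun k _ =>
    ENNReal.measurable_ofReal.comp ((measurable_pi_apply k).norm.pow_const _)
  have hpermm : ∀ π : Equiv.Perm (Fin n),
      Measurable fun ξ : Fin n → EuclideanSpace ℝ (Fin d) => ξ ∘ π := fun π =>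
    measurable_pi_lambda _ fun k => measurable_pi_apply _
  -- The majorant for one suffix sum: the weight contributes a^{-ρ}(a + ‖u‖)^{2ρ} and the squared
  -- resolvent (a + ‖u‖)^{-2β}, up to constants.
  set q : EuclideanSpace ℝ (Fin d) → ℝ≥0∞ := fun u =>
    ENNReal.ofReal ((1 / c') ^ 2 * a ^ (-ρ)) *
      ENNReal.ofReal ((a + ‖u‖) ^ (-(2 * β - 2 * ρ)))
  have hqm : Measurable fun u : EuclideanSpace ℝ (Fin d) =>
      ENNReal.ofReal ((a + ‖u‖) ^ (-(2 * β - 2 * ρ))) :=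
    ENNReal.measurable_ofReal.comp ((measurable_norm.const_add _).pow_const _)
  have hpt : ∀ ξ, w ξ * G ξ ^ 2 ≤ ∏ k, q (suffixSum ξ k) := by
    intro ξ
    have h1 : ∏ j, ‖ξ j‖ ^ ρ ≤ ∏ k, ((a + ‖suffixSum ξ k‖) ^ 2 / a) ^ ρ := by
      rw [Real.finsetProd_rpow _ _ fun _ _ => norm_nonneg _,
        Real.finsetProd_rpow _ _ fun _ _ => by positivity]
      exact Real.rpow_le_rpow (Finset.prod_nonneg fun _ _ => norm_nonneg _)
        (prod_norm_le_prod_suffixSum ha ξ) hρ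
    have h2 : w ξ ≤ ∏ k, ENNReal.ofReal (((a + ‖suffixSum ξ k‖) ^ 2 / a) ^ ρ) := by
      simp only [w]
      rw [← ENNReal.ofReal_prod_of_nonneg fun _ _ => by positivity,
        ← ENNReal.ofReal_prod_of_nonneg fun _ _ => by positivity]
      exact ENNReal.ofReal_le_ofReal h1
    calc w ξ * G ξ ^ 2
        ≤ (∏ k, ENNReal.ofReal (((a + ‖suffixSum ξ k‖) ^ 2 / a) ^ ρ)) * G ξ ^ 2 := by gcongr
      _ = ∏ k, (ENNReal.ofReal (((a + ‖suffixSum ξ k‖) ^ 2 / a) ^ ρ) *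
            ENNReal.ofReal (1 / (a ^ β + κ (suffixSum ξ k))) ^ 2) := by
          rw [Finset.prod_mul_distrib, Finset.prod_pow]
      _ ≤ ∏ k, q (suffixSum ξ k) := by
          refine Finset.prod_le_prod' fun k _ => ?_
          set u := suffixSum ξ k
          have hpos : 0 < a + ‖u‖ := by positivity
          have hinv : 1 / (a ^ β + κ u) ≤ 1 / (c' * (a + ‖u‖) ^ β) :=
            one_div_le_one_div_of_le (by positivity) (hlow u)
          have hnn : 0 ≤ 1 / (a ^ β + κ u) :=
            one_div_nonneg.2 (le_trans (by positivity) (hlow u))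
          simp only [q]
          rw [← ENNReal.ofReal_pow hnn, ← ENNReal.ofReal_mul (by positivity),
            ← ENNReal.ofReal_mul (by positivity)]
          refine ENNReal.ofReal_le_ofReal ?_
          calc ((a + ‖u‖) ^ 2 / a) ^ ρ * (1 / (a ^ β + κ u)) ^ 2
              ≤ ((a + ‖u‖) ^ 2 / a) ^ ρ * (1 / (c' * (a + ‖u‖) ^ β)) ^ 2 := by gcongr
            _ = (1 / c') ^ 2 * a ^ (-ρ) * (a + ‖u‖) ^ (-(2 * β - 2 * ρ)) := by
              rw [Real.div_rpow (by positivity) ha.le, ← Real.rpow_natCast (a + ‖u‖) 2,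
                ← Real.rpow_mul hpos.le, Real.rpow_neg ha.le,
                show -(2 * β - 2 * ρ) = ((2 : ℕ) : ℝ) * ρ - (β + β) by push_cast; ring,
                Real.rpow_sub hpos, Real.rpow_add hpos]
              field_simp
  -- Permuting coordinates preserves Lebesgue measure and the weight, so all n! terms are equal;
  -- Cauchy-Schwarz contributes the other n!.
  have hperm : ∀ π : Equiv.Perm (Fin n), ∫⁻ ξ, w ξ * G (ξ ∘ π) ^ 2 = ∫⁻ ξ, w ξ * G ξ ^ 2 := by
    intro π
    have hmp := volume_measurePreserving_piCongrLeft
      (fun _ : Fin n => EuclideanSpace ℝ (Fin d)) π.symm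
    rw [← hmp.lintegral_comp_emb (MeasurableEquiv.measurableEmbedding _)
      (fun ξ => w ξ * G ξ ^ 2)]
    refine lintegral_congr fun ξ => ?_
    have hξ : MeasurableEquiv.piCongrLeft (fun _ : Fin n => EuclideanSpace ℝ (Fin d)) π.symm ξ =
        ξ ∘ π := by
      ext1 k
      have := MeasurableEquiv.piCongrLeft_apply_apply
        (β := fun _ : Fin n => EuclideanSpace ℝ (Fin d)) π.symm ξ (π k)
      simpa using this
    rw [hξ]
    congr 1
    exact (Equiv.prod_comp π fun j => ENNReal.ofReal (‖ξ j‖ ^ ρ)).symm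
  have hq : ∫⁻ u, q u = ENNReal.ofReal ((1 / c') ^ 2 * I * a ^ (d + ρ - 2 * β)) := by
    simp only [q]
    rw [lintegral_const_mul _ hqm, lintegral_add_norm_rpow ha (by linarith),
      ← ENNReal.ofReal_mul (by positivity)]
    congr 1
    rw [show (d : ℝ) + ρ - 2 * β = -ρ + (d - (2 * β - 2 * ρ)) by ring, Real.rpow_add ha]
    ring
  calc ∫⁻ ξ, w ξ * (∑ π : Equiv.Perm (Fin n), G (ξ ∘ π)) ^ 2
      ≤ ∫⁻ ξ, (n.factorial : ℝ≥0∞) * ∑ π : Equiv.Perm (Fin n), w ξ * G (ξ ∘ π) ^ 2 := by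
        refine lintegral_mono fun ξ => ?_
        refine (mul_le_mul_right (ENNReal.sq_sum_le_card_mul_sum_sq _ _) _).trans_eq ?_
        rw [Finset.card_univ, Fintype.card_perm, Fintype.card_fin, ← Finset.mul_sum]
        ring
    _ = (n.factorial : ℝ≥0∞) * ∑ π : Equiv.Perm (Fin n), ∫⁻ ξ, w ξ * G (ξ ∘ π) ^ 2 := by
        have hm : ∀ π : Equiv.Perm (Fin n), Measurable fun ξ => w ξ * G (ξ ∘ π) ^ 2 := fun π =>
          hwm.mul ((hGm.comp (hpermm π)).pow_const 2)
        rw [lintegral_const_mul _ (Finset.measurable_sum _ fun π _ => hm π),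
          lintegral_finsetSum _ fun π _ => hm π]
    _ = (n.factorial : ℝ≥0∞) ^ 2 * ∫⁻ ξ, w ξ * G ξ ^ 2 := by
        simp_rw [hperm]
        rw [Finset.sum_const, Finset.card_univ, Fintype.card_perm, Fintype.card_fin,
          nsmul_eq_mul]
        ring
    _ ≤ (n.factorial : ℝ≥0∞) ^ 2 * (∫⁻ u, q u) ^ n := by
        rw [← lintegral_prod_suffixSum n q (hqm.const_mul _)]
        gcongr
        exact hpt _
    _ = _ := by
        rw [hq, ← ENNReal.ofReal_pow (by positivity), ENNReal.ofReal_mul (by positivity),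
          ENNReal.ofReal_pow (Nat.cast_nonneg _), ENNReal.ofReal_natCast]

/-! ### Joint measurability of the paths in time and sample point -/

/-- The `+ 1` keeps the grid points on the right of `s`, the side on which càdlàg paths are
continuous. -/
theorem tendsto_natFloor_mul_add_one_div (s : ℝ≥0) :
    Tendsto (fun n : ℕ => ((⌊(n + 1 : ℝ≥0) * s⌋₊ + 1 : ℕ) : ℝ≥0) / (n + 1 : ℝ≥0)) atTop
      (𝓝[≥] s) := by
  have hlow : ∀ n : ℕ, s ≤ ((⌊(n + 1 : ℝ≥0) * s⌋₊ + 1 : ℕ) : ℝ≥0) / (n + 1 : ℝ≥0) := by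
    intro n
    rw [le_div_iff₀ (by positivity), mul_comm]
    exact_mod_cast (Nat.lt_floor_add_one ((n + 1 : ℝ≥0) * s)).le
  have hup : ∀ n : ℕ, ((⌊(n + 1 : ℝ≥0) * s⌋₊ + 1 : ℕ) : ℝ≥0) / (n + 1 : ℝ≥0) ≤
      s + 1 / ((n : ℝ≥0) + 1) := by
    intro n
    rw [div_le_iff₀ (by positivity), add_mul s, one_div, inv_mul_cancel₀ (by positivity)]
    push_cast
    gcongr
    rw [mul_comm s]
    exact Nat.floor_le zero_le
  refine tendsto_nhdsWithin_iff.2 ⟨?_, Eventually.of_forall hlow⟩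
  refine tendsto_of_tendsto_of_tendsto_of_le_of_le tendsto_const_nhds ?_ hlow hup
  have : Tendsto (fun n : ℕ => s + 1 / ((n : ℝ≥0) + 1)) atTop (𝓝 (s + 0)) :=
    tendsto_const_nhds.add tendsto_one_div_add_atTop_nhds_zero_nat
  simpa using this

/-- A process with almost surely càdlàg paths has a jointly measurable version. -/
theorem exists_measurable_version {E Ω : Type*} [MeasurableSpace Ω] [TopologicalSpace E]
    [TopologicalSpace.PseudoMetrizableSpace E] [Zero E] [MeasurableSpace E] [BorelSpace E]
    {P : Measure Ω} {X : ℝ≥0 → Ω → E} (hXm : ∀ t, Measurable (X t))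
    (hX : ∀ᵐ ω ∂P, IsCadlag fun t => X t ω) :
    ∃ Y : ℝ → Ω → E, Measurable (Function.uncurry Y) ∧
      ∀ᵐ ω ∂P, ∀ s, Y s ω = X s.toNNReal ω := by
  -- Setting the process to zero off a measurable set of full measure makes every path right
  -- continuous. It is then a pointwise limit of grid approximations, which are measurable because
  -- the grid is countable.
  set S : Set Ω := (toMeasurable P {ω | ¬ IsCadlag fun t => X t ω})ᶜ
  have hSm : MeasurableSet S := (measurableSet_toMeasurable _ _).compl
  have hS : ∀ ω ∈ S, IsCadlag fun t => X t ω := by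
    intro ω hω
    by_contra h
    exact hω (subset_toMeasurable _ _ h)
  have hSae : ∀ᵐ ω ∂P, ω ∈ S := by
    rw [ae_iff] at hX ⊢
    simpa [S] using hX
  refine ⟨fun s => S.indicator (X s.toNNReal), ?_, ?_⟩
  · refine measurable_of_tendsto_metrizable (f := fun (n : ℕ) (z : ℝ × Ω) =>
      S.indicator (X (((⌊(n + 1 : ℝ≥0) * z.1.toNNReal⌋₊ + 1 : ℕ) : ℝ≥0) / (n + 1 : ℝ≥0))) z.2)
      (fun n => ?_) (tendsto_pi_nhds.2 fun z => ?_)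
    · have h1 : Measurable fun w : ℕ × Ω =>
          S.indicator (X (((w.1 + 1 : ℕ) : ℝ≥0) / (n + 1 : ℝ≥0))) w.2 :=
        measurable_from_prod_countable_right fun k =>
          (hXm (((k + 1 : ℕ) : ℝ≥0) / (n + 1 : ℝ≥0))).indicator hSm
      have h2 : Measurable fun z : ℝ × Ω => (⌊(n + 1 : ℝ≥0) * z.1.toNNReal⌋₊, z.2) :=
        (Nat.measurable_floor.comp ((measurable_real_toNNReal.comp measurable_fst).const_mul
          _)).prodMk measurable_snd
      exact h1.comp h2
    · by_cases hz : z.2 ∈ S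
      · simp only [Function.uncurry, Set.indicator_of_mem hz]
        exact (hS _ hz z.1.toNNReal).1.tendsto.comp (tendsto_natFloor_mul_add_one_div _)
      · simp only [Function.uncurry, Set.indicator_of_notMem hz]
        exact tendsto_const_nhds
  · filter_upwards [hSae] with ω hω s
    simp [Set.indicator_of_mem hω]

/-! ### Fourier representation of the mollifier -/

open FourierTransform in
/-- The approximate delta functions are superpositions of characters whose amplitudes are
bounded and Lipschitz, hence Hölder, in the scale `ε`. -/
theorem exists_fourier_representation_approxDelta {d : ℕ}
    (f : SchwartzMap (EuclideanSpace ℝ (Fin d)) ℝ) :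
    ∃ (h : EuclideanSpace ℝ (Fin d) → ℂ) (C : ℝ), Continuous h ∧ Integrable h ∧ 0 < C ∧
      (∀ ε : ℝ, 0 < ε → ∀ x, (approxDelta f ε x : ℂ) =
        ∫ ξ, h (ε • ξ) * Complex.exp ((inner ℝ x ((2 * Real.pi) • ξ) : ℝ) * Complex.I)) ∧
      ∀ ρ : ℝ, 0 ≤ ρ → ρ ≤ 1 → ∀ (ε ε' : ℝ) (ξ : EuclideanSpace ℝ (Fin d)),
        ‖h (ε • ξ) - h (ε' • ξ)‖ ≤ C * (|ε - ε'| * ‖ξ‖) ^ ρ := by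
  set F : SchwartzMap (EuclideanSpace ℝ (Fin d)) ℂ :=
    SchwartzMap.postcompCLM Complex.ofRealCLM f
  set h : SchwartzMap (EuclideanSpace ℝ (Fin d)) ℂ := 𝓕 F with hh
  obtain ⟨M, hM⟩ := h.decay 0 0
  obtain ⟨L, hL⟩ := h.decay 0 1
  have hM' : ∀ x, ‖h x‖ ≤ M := fun x => by simpa using hM.2 x
  have hL' : ∀ x, ‖fderiv ℝ h x‖ ≤ L := fun x => by
    simpa [norm_iteratedFDeriv_one] using hL.2 x
  have hlip : ∀ x y, ‖h x - h y‖ ≤ L * ‖x - y‖ := fun x y =>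
    Convex.norm_image_sub_le_of_norm_fderiv_le (𝕜 := ℝ)
      (fun z _ => h.differentiableAt) (fun z _ => hL' z) convex_univ
      (Set.mem_univ y) (Set.mem_univ x)
  have hinv : ∀ x, (f x : ℂ) = ∫ ξ, h ξ *
      Complex.exp ((inner ℝ x ((2 * Real.pi) • ξ) : ℝ) * Complex.I) := by
    intro x
    have h1 : F x = (𝓕⁻ h) x := by rw [hh, FourierPair.fourierInv_fourier_eq]
    have h2 : F x = (f x : ℂ) := rfl
    rw [← h2, h1, SchwartzMap.fourierInv_coe, Real.fourierInv_eq']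
    refine integral_congr_ae (Eventually.of_forall fun ξ => ?_)
    simp only [smul_eq_mul]
    rw [mul_comm, inner_smul_right, real_inner_comm]
  -- `M` bounds h and `L` its derivative, so the difference is at most min(2M, Lx) with x = |ε -
  -- ε'|‖ξ‖. For 0 ≤ ρ ≤ 1 this is at most (2M + L) x^ρ, whether x ≤ 1 or x ≥ 1.
  refine ⟨h, 2 * M + L, h.continuous, h.integrable, by linarith [hM.1, hL.1], ?_, ?_⟩
  · intro ε hε x
    have hsub := Measure.integral_comp_smul (volume : Measure (EuclideanSpace ℝ (Fin d)))
      (fun ξ => h ξ *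
        Complex.exp ((inner ℝ (ε⁻¹ • x) ((2 * Real.pi) • ξ) : ℝ) * Complex.I)) ε
    rw [← hinv, finrank_euclideanSpace_fin, abs_of_pos (by positivity)] at hsub
    have hin : ∀ ξ : EuclideanSpace ℝ (Fin d),
        inner ℝ (ε⁻¹ • x) ((2 * Real.pi) • ε • ξ) = inner ℝ x ((2 * Real.pi) • ξ) := by
      intro ξ
      simp only [inner_smul_left, inner_smul_right, RCLike.conj_to_real]
      field_simp
    simp_rw [hin] at hsub
    rw [hsub, approxDelta]
    rw [Complex.real_smul]
    push_cast
    ring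
  · intro ρ hρ0 hρ1 ε ε' ξ
    have hx : 0 ≤ |ε - ε'| * ‖ξ‖ := by positivity
    set x := |ε - ε'| * ‖ξ‖
    have hb1 : ‖h (ε • ξ) - h (ε' • ξ)‖ ≤ L * x := by
      refine (hlip _ _).trans_eq ?_
      rw [← sub_smul, norm_smul, Real.norm_eq_abs]
    have hb2 : ‖h (ε • ξ) - h (ε' • ξ)‖ ≤ 2 * M :=
      (norm_sub_le _ _).trans (by linarith [hM' (ε • ξ), hM' (ε' • ξ)])
    have hxρ : 0 ≤ x ^ ρ := Real.rpow_nonneg hx _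
    rcases le_total x 1 with h1 | h1
    · have : x ≤ x ^ ρ := by
        rcases hx.eq_or_lt with h0 | h0
        · rw [← h0] at hxρ ⊢; exact hxρ
        · simpa using Real.rpow_le_rpow_of_exponent_ge h0 h1 hρ1
      nlinarith [hM.1, hL.1, mul_le_mul_of_nonneg_left this hL.1.le, mul_nonneg hM.1.le hxρ]
    · have : 1 ≤ x ^ ρ := Real.one_le_rpow h1 hρ0
      nlinarith [hM.1, hL.1, mul_le_mul_of_nonneg_left this hM.1.le, mul_nonneg hL.1.le hxρ]

/-! ### Moments as integrals over frequencies and times -/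

/-- Regroups N triples (frequency, time, time) into three N-tuples and integrates the times
separately, one factor `b` for each process. Only the inequality half of Tonelli's theorem is used,
which needs no measurability; finiteness serves to pull constants out of integrals. -/
theorem lintegral_pi_triple_le {E : Type*} [MeasureSpace E] [SigmaFinite (volume : Measure E)]
    {N : ℕ} {t : ℝ} {W b : (Fin N → E) → ℝ≥0∞} {B B' : (Fin N → E) → (Fin N → ℝ) → ℝ≥0∞}
    (hW : ∀ ξ, W ξ ≠ ∞) (hb : ∀ ξ, b ξ ≠ ∞) (hB : ∀ ξ s, B ξ s ≠ ∞)
    (hBb : ∀ ξ, ∫⁻ s in {s : Fin N → ℝ | ∀ k, s k ∈ Set.Icc 0 t}, B ξ s ≤ b ξ)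
    (hBb' : ∀ ξ, ∫⁻ s in {s : Fin N → ℝ | ∀ k, s k ∈ Set.Icc 0 t}, B' ξ s ≤ b ξ) :
    ∫⁻ z : Fin N → E × ℝ × ℝ, W (fun j => (z j).1) *
        (B (fun j => (z j).1) (fun j => (z j).2.1) * B' (fun j => (z j).1) fun j => (z j).2.2)
      ∂(Measure.pi fun _ => (volume : Measure E).prod ((volume.restrict (Set.Icc 0 t)).prod
        (volume.restrict (Set.Icc 0 t)))) ≤ ∫⁻ ξ, W ξ * b ξ ^ 2 := by
  set ν : Measure ℝ := volume.restrict (Set.Icc 0 t)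
  have hν : (Measure.pi fun _ : Fin N => ν) =
      volume.restrict {s : Fin N → ℝ | ∀ k, s k ∈ Set.Icc 0 t} := by
    rw [volume_pi, show {s : Fin N → ℝ | ∀ k, s k ∈ Set.Icc 0 t} =
      Set.univ.pi fun _ => Set.Icc 0 t by
        ext; simp only [Set.mem_ofPred_eq, Set.mem_univ_pi], Measure.restrict_pi_pi]
  have hmp1 := measurePreserving_arrowProdEquivProdArrow E (ℝ × ℝ) (Fin N)
    (fun _ => (volume : Measure E)) (fun _ => ν.prod ν)
  have hmp2 := measurePreserving_arrowProdEquivProdArrow ℝ ℝ (Fin N) (fun _ => ν) (fun _ => ν)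
  have e1 := hmp1.lintegral_comp_emb (MeasurableEquiv.measurableEmbedding _)
    (fun y : (Fin N → E) × (Fin N → ℝ × ℝ) => W y.1 *
      (B y.1 (fun j => (y.2 j).1) * B' y.1 fun j => (y.2 j).2))
  refine (Eq.le ?_).trans ((e1.le.trans (lintegral_prod_le _)).trans ?_)
  · rfl
  rw [← volume_pi]
  refine lintegral_mono fun ξ => ?_
  have e2 := hmp2.lintegral_comp_emb (MeasurableEquiv.measurableEmbedding _)
    (fun y : (Fin N → ℝ) × (Fin N → ℝ) => W ξ * (B ξ y.1 * B' ξ y.2))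
  refine (Eq.le ?_).trans ((e2.le.trans (lintegral_prod_le _)).trans ?_)
  · rfl
  rw [hν]
  calc _ = ∫⁻ s in {s : Fin N → ℝ | ∀ k, s k ∈ Set.Icc 0 t},
        W ξ * (B ξ s * ∫⁻ r in {s : Fin N → ℝ | ∀ k, s k ∈ Set.Icc 0 t}, B' ξ r) := by
        refine lintegral_congr fun s => ?_
        rw [lintegral_const_mul' _ _ (hW ξ), lintegral_const_mul' _ _ (hB ξ s)]
    _ ≤ ∫⁻ s in {s : Fin N → ℝ | ∀ k, s k ∈ Set.Icc 0 t}, W ξ * (B ξ s * b ξ) := by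
        gcongr
        exact hBb' ξ
    _ = W ξ * ((∫⁻ s in {s : Fin N → ℝ | ∀ k, s k ∈ Set.Icc 0 t}, B ξ s) * b ξ) := by
        rw [lintegral_const_mul' _ _ (hW ξ), lintegral_mul_const' _ _ (hb ξ)]
    _ ≤ W ξ * b ξ ^ 2 := by
        rw [sq]
        gcongr
        exact hBb ξ

/-- The power of an integral is an integral over N copies of the space, and Fubini applies because ∏
G(z_j) is an integrable majorant independent of ω. -/
theorem integrable_and_integral_pow_integral_eq {Z Ω : Type*} [MeasurableSpace Z] [MeasurableSpace Ω]
    {m : Measure Z} [SigmaFinite m] {P : Measure Ω} [IsFiniteMeasure P] {φ : Z → Ω → ℂ}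
    (hφm : Measurable (Function.uncurry φ)) {G : Z → ℝ} (hG : Integrable G m)
    (hφ : ∀ z ω, ‖φ z ω‖ ≤ G z) {N : ℕ} :
    Integrable (fun ω => (∫ z, φ z ω ∂m) ^ N) P ∧ ∫ ω, (∫ z, φ z ω ∂m) ^ N ∂P =
      ∫ z : Fin N → Z, ∫ ω, ∏ j, φ (z j) ω ∂P ∂(Measure.pi fun _ => m) := by
  have hpow : ∀ ω, (∫ z, φ z ω ∂m) ^ N =
      ∫ z : Fin N → Z, ∏ j, φ (z j) ω ∂(Measure.pi fun _ => m) := by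
    intro ω
    rw [integral_fintype_prod_eq_pow (fun z => φ z ω), Fintype.card_fin]
  have hprod : Integrable (fun z : Fin N → Z => ∏ j, G (z j)) (Measure.pi fun _ => m) :=
    Integrable.fintype_prod (f := fun _ => G) fun _ => hG
  have hdom : Integrable (fun y : Ω × (Fin N → Z) => ∏ j, G (y.2 j))
      (P.prod (Measure.pi fun _ => m)) := hprod.comp_snd P
  have hint : Integrable (Function.uncurry fun (ω : Ω) (z : Fin N → Z) => ∏ j, φ (z j) ω)
      (P.prod (Measure.pi fun _ => m)) := by
    refine hdom.mono' (Measurable.aestronglyMeasurable ?_) (Eventually.of_forall fun y => ?_)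
    · refine Finset.measurable_prod _ fun j _ => ?_
      have hj : Measurable fun y : Ω × (Fin N → Z) => (y.2 j, y.1) := by fun_prop
      exact hφm.comp hj
    · simp only [Function.uncurry, norm_prod]
      exact Finset.prod_le_prod (fun _ _ => norm_nonneg _) fun j _ => hφ _ _
  simp_rw [hpow]
  exact ⟨hint.integral_prod_left, integral_integral_swap hint⟩

section

variable {d : ℕ} {Ω : Type*} [MeasurableSpace Ω] {P : Measure Ω}
    {X X' : ℝ≥0 → Ω → EuclideanSpace ℝ (Fin d)}

/-- The character of a difference is one character times the conjugate of the other; independence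
splits the expectation, and conjugation does not change the modulus. -/
theorem enorm_integral_exp_sum_sub [IsProbabilityMeasure P]
    (hX : ∀ t, Measurable (X t)) (hX' : ∀ t, Measurable (X' t))
    (hindep : IndepFun (fun ω t => X t ω) (fun ω t => X' t ω) P) {N : ℕ}
    (s r : Fin N → ℝ≥0) (ξ : Fin N → EuclideanSpace ℝ (Fin d)) :
    ‖∫ ω, Complex.exp ((∑ j, inner ℝ (X (s j) ω - X' (r j) ω) (ξ j) : ℝ) * Complex.I) ∂P‖ₑ =
      ‖∫ ω, Complex.exp ((∑ j, inner ℝ (X (s j) ω) (ξ j) : ℝ) * Complex.I) ∂P‖ₑ *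
      ‖∫ ω, Complex.exp ((∑ j, inner ℝ (X' (r j) ω) (ξ j) : ℝ) * Complex.I) ∂P‖ₑ := by
  have hmeas : ∀ s : Fin N → ℝ≥0, Measurable fun x : ℝ≥0 → EuclideanSpace ℝ (Fin d) =>
      Complex.exp ((∑ j, inner ℝ (x (s j)) (ξ j) : ℝ) * Complex.I) := by
    intro s
    have : Measurable fun x : ℝ≥0 → EuclideanSpace ℝ (Fin d) => ∑ j, inner ℝ (x (s j)) (ξ j) :=
      Finset.measurable_sum _ fun j _ => (measurable_pi_apply (s j)).inner_const
    fun_prop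
  set U : Ω → ℂ := fun ω => Complex.exp ((∑ j, inner ℝ (X (s j) ω) (ξ j) : ℝ) * Complex.I)
  set V : Ω → ℂ := fun ω => Complex.exp ((∑ j, inner ℝ (X' (r j) ω) (ξ j) : ℝ) * Complex.I)
  have hU : Measurable U := by
    have : Measurable fun ω => ∑ j, inner ℝ (X (s j) ω) (ξ j) :=
      Finset.measurable_sum _ fun j _ => (hX (s j)).inner_const
    fun_prop
  have hV : Measurable fun ω => (starRingEnd ℂ) (V ω) := by
    have : Measurable fun ω => ∑ j, inner ℝ (X' (r j) ω) (ξ j) :=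
      Finset.measurable_sum _ fun j _ => (hX' (r j)).inner_const
    exact Complex.continuous_conj.measurable.comp (by fun_prop)
  have hUV : IndepFun U (fun ω => (starRingEnd ℂ) (V ω)) P :=
    hindep.comp (hmeas s) (Complex.continuous_conj.measurable.comp (hmeas r))
  have hmul : ∫ ω, U ω * (starRingEnd ℂ) (V ω) ∂P =
      (∫ ω, U ω ∂P) * ∫ ω, (starRingEnd ℂ) (V ω) ∂P :=
    hUV.integral_fun_mul_eq_mul_integral hU.aestronglyMeasurable hV.aestronglyMeasurable
  have hcongr : ∀ ω, Complex.exp ((∑ j, inner ℝ (X (s j) ω - X' (r j) ω) (ξ j) : ℝ) * Complex.I) =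
      U ω * (starRingEnd ℂ) (V ω) := by
    intro ω
    simp only [U, V]
    rw [← Complex.exp_conj, ← Complex.exp_add, map_mul, Complex.conj_ofReal, Complex.conj_I]
    simp_rw [inner_sub_left]
    rw [Finset.sum_sub_distrib]
    push_cast
    ring_nf
  simp_rw [hcongr]
  rw [hmul, integral_conj, enorm_mul, ← ofReal_norm ((starRingEnd ℂ) _), Complex.norm_conj,
    ofReal_norm]

/-- The moment of a superposition of characters of `X_s - X'_r`, in terms of the joint
characteristic functions of the two independent processes. -/
theorem integrable_and_enorm_integral_pow_le [IsProbabilityMeasure P]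
    (hX : ∀ t, Measurable (X t)) (hX' : ∀ t, Measurable (X' t))
    (hindep : IndepFun (fun ω t => X t ω) (fun ω t => X' t ω) P)
    {Y Y' : ℝ → Ω → EuclideanSpace ℝ (Fin d)}
    (hY : Measurable (Function.uncurry Y)) (hY' : Measurable (Function.uncurry Y'))
    (hYX : ∀ᵐ ω ∂P, ∀ s, Y s ω = X s.toNNReal ω)
    (hYX' : ∀ᵐ ω ∂P, ∀ s, Y' s ω = X' s.toNNReal ω)
    {g : EuclideanSpace ℝ (Fin d) → ℂ} (hgc : Continuous g) (hg : Integrable g)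
    {t : ℝ} {N : ℕ} {b : (Fin N → EuclideanSpace ℝ (Fin d)) → ℝ≥0∞} (hb : ∀ ξ, b ξ ≠ ∞)
    (hXb : ∀ ξ, ∫⁻ s in {s : Fin N → ℝ | ∀ k, s k ∈ Set.Icc 0 t},
      ‖∫ ω, Complex.exp ((∑ j, inner ℝ (X (s j).toNNReal ω) ((2 * Real.pi) • ξ j) : ℝ) *
        Complex.I) ∂P‖ₑ ≤ b ξ)
    (hXb' : ∀ ξ, ∫⁻ s in {s : Fin N → ℝ | ∀ k, s k ∈ Set.Icc 0 t},
      ‖∫ ω, Complex.exp ((∑ j, inner ℝ (X' (s j).toNNReal ω) ((2 * Real.pi) • ξ j) : ℝ) *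
        Complex.I) ∂P‖ₑ ≤ b ξ) :
    Integrable (fun ω => (∫ z, g z.1 * Complex.exp
        ((inner ℝ (Y z.2.1 ω - Y' z.2.2 ω) ((2 * Real.pi) • z.1) : ℝ) * Complex.I)
        ∂((volume : Measure (EuclideanSpace ℝ (Fin d))).prod
          ((volume.restrict (Set.Icc 0 t)).prod (volume.restrict (Set.Icc 0 t))))) ^ N) P ∧
    ‖∫ ω, (∫ z, g z.1 * Complex.exp
        ((inner ℝ (Y z.2.1 ω - Y' z.2.2 ω) ((2 * Real.pi) • z.1) : ℝ) * Complex.I)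
        ∂((volume : Measure (EuclideanSpace ℝ (Fin d))).prod
          ((volume.restrict (Set.Icc 0 t)).prod (volume.restrict (Set.Icc 0 t))))) ^ N ∂P‖ₑ ≤
      ∫⁻ ξ, (∏ j, ‖g (ξ j)‖ₑ) * b ξ ^ 2 := by
  set m := (volume : Measure (EuclideanSpace ℝ (Fin d))).prod
          ((volume.restrict (Set.Icc 0 t)).prod (volume.restrict (Set.Icc 0 t)))
  set φ : EuclideanSpace ℝ (Fin d) × ℝ × ℝ → Ω → ℂ := fun z ω => g z.1 * Complex.exp
        ((inner ℝ (Y z.2.1 ω - Y' z.2.2 ω) ((2 * Real.pi) • z.1) : ℝ) * Complex.I)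
  have hφm : Measurable (Function.uncurry φ) := by
    have h1 : Measurable fun y : (EuclideanSpace ℝ (Fin d) × ℝ × ℝ) × Ω => Y y.1.2.1 y.2 :=
      hY.comp (measurable_fst.snd.fst.prodMk measurable_snd)
    have h2 : Measurable fun y : (EuclideanSpace ℝ (Fin d) × ℝ × ℝ) × Ω => Y' y.1.2.2 y.2 :=
      hY'.comp (measurable_fst.snd.snd.prodMk measurable_snd)
    have h3 : Measurable fun y : (EuclideanSpace ℝ (Fin d) × ℝ × ℝ) × Ω => g y.1.1 :=
      hgc.measurable.comp measurable_fst.fst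
    have h4 : Measurable fun y : (EuclideanSpace ℝ (Fin d) × ℝ × ℝ) × Ω =>
        inner ℝ (Y y.1.2.1 y.2 - Y' y.1.2.2 y.2) ((2 * Real.pi) • y.1.1) :=
      (h1.sub h2).inner (Measurable.const_smul (g := fun y :
        (EuclideanSpace ℝ (Fin d) × ℝ × ℝ) × Ω => y.1.1) measurable_fst.fst (2 * Real.pi))
    exact h3.mul (by fun_prop)
  have hφn : ∀ z ω, ‖φ z ω‖ = ‖g z.1‖ := fun z ω => by
    simp only [φ]
    rw [norm_mul, Complex.norm_exp_ofReal_mul_I, mul_one]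
  have hgm : Integrable (fun z : EuclideanSpace ℝ (Fin d) × ℝ × ℝ => ‖g z.1‖) m :=
    hg.norm.comp_fst _
  obtain ⟨hpint, hpeq⟩ := integrable_and_integral_pow_integral_eq (P := P) (N := N) hφm hgm
    fun z ω => (hφn z ω).le
  refine ⟨hpint, ?_⟩
  rw [hpeq]
  refine (enorm_integral_le_lintegral_enorm _).trans ?_
  have hfac : ∀ z : Fin N → EuclideanSpace ℝ (Fin d) × ℝ × ℝ, ‖∫ ω, ∏ j, φ (z j) ω ∂P‖ₑ =
      (∏ j, ‖g (z j).1‖ₑ) *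
      (‖∫ ω, Complex.exp ((∑ j, inner ℝ (X ((z j).2.1).toNNReal ω) ((2 * Real.pi) • (z j).1) : ℝ) *
        Complex.I) ∂P‖ₑ *
      ‖∫ ω, Complex.exp ((∑ j, inner ℝ (X' ((z j).2.2).toNNReal ω) ((2 * Real.pi) • (z j).1) : ℝ) *
        Complex.I) ∂P‖ₑ) := by
    intro z
    rw [← enorm_integral_exp_sum_sub hX hX' hindep (fun j => ((z j).2.1).toNNReal)
      (fun j => ((z j).2.2).toNNReal) (fun j => (2 * Real.pi) • (z j).1)]
    have hcongr : ∀ᵐ ω ∂P, ∏ j, φ (z j) ω = (∏ j, g (z j).1) * Complex.exp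
        ((∑ j, inner ℝ (X ((z j).2.1).toNNReal ω - X' ((z j).2.2).toNNReal ω)
          ((2 * Real.pi) • (z j).1) : ℝ) * Complex.I) := by
      filter_upwards [hYX, hYX'] with ω h1 h2
      simp only [φ, h1, h2]
      rw [Finset.prod_mul_distrib, ← Complex.exp_sum, ← Finset.sum_mul]
      push_cast
      rfl
    rw [integral_congr_ae hcongr, integral_const_mul, enorm_mul]
    congr 1
    simp only [← ofReal_norm, norm_prod]
    rw [ENNReal.ofReal_prod_of_nonneg fun _ _ => norm_nonneg _]
  simp_rw [hfac]
  exact lintegral_pi_triple_le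
    (W := fun ξ => ∏ j, ‖g (ξ j)‖ₑ)
    (B := fun ξ s => ‖∫ ω, Complex.exp ((∑ j, inner ℝ (X (s j).toNNReal ω)
      ((2 * Real.pi) • ξ j) : ℝ) * Complex.I) ∂P‖ₑ)
    (B' := fun ξ s => ‖∫ ω, Complex.exp ((∑ j, inner ℝ (X' (s j).toNNReal ω)
      ((2 * Real.pi) • ξ j) : ℝ) * Complex.I) ∂P‖ₑ)
    (fun ξ => ENNReal.prod_ne_top fun _ _ => enorm_ne_top) hb (fun _ _ => enorm_ne_top) hXb hXb'

end

/-- A pathwise use of Fubini: ‖k‖ is an integrable majorant over the bounded time square, so the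
frequency integral can be performed first or last. -/
theorem integral_prod_character_eq {d : ℕ} {F : EuclideanSpace ℝ (Fin d) → ℝ}
    {k : EuclideanSpace ℝ (Fin d) → ℂ} (hkc : Continuous k) (hk : Integrable k)
    (hF : ∀ x, (F x : ℂ) =
      ∫ ξ, k ξ * Complex.exp ((inner ℝ x ((2 * Real.pi) • ξ) : ℝ) * Complex.I))
    {y y' : ℝ → EuclideanSpace ℝ (Fin d)} (hy : Measurable y) (hy' : Measurable y')
    {t : ℝ} (ht : 0 ≤ t) :
    Integrable (fun z : EuclideanSpace ℝ (Fin d) × ℝ × ℝ => k z.1 * Complex.exp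
        ((inner ℝ (y z.2.1 - y' z.2.2) ((2 * Real.pi) • z.1) : ℝ) * Complex.I))
      ((volume : Measure (EuclideanSpace ℝ (Fin d))).prod
        ((volume.restrict (Set.Icc 0 t)).prod (volume.restrict (Set.Icc 0 t)))) ∧
    ((∫ s in (0 : ℝ)..t, ∫ r in (0 : ℝ)..t, F (y s - y' r) : ℝ) : ℂ) =
      ∫ z, k z.1 * Complex.exp
        ((inner ℝ (y z.2.1 - y' z.2.2) ((2 * Real.pi) • z.1) : ℝ) * Complex.I)
      ∂((volume : Measure (EuclideanSpace ℝ (Fin d))).prod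
        ((volume.restrict (Set.Icc 0 t)).prod (volume.restrict (Set.Icc 0 t)))) := by
  set ν : Measure ℝ := volume.restrict (Set.Icc 0 t)
  have hint : Integrable (fun z : EuclideanSpace ℝ (Fin d) × ℝ × ℝ => k z.1 * Complex.exp
      ((inner ℝ (y z.2.1 - y' z.2.2) ((2 * Real.pi) • z.1) : ℝ) * Complex.I))
      ((volume : Measure (EuclideanSpace ℝ (Fin d))).prod (ν.prod ν)) := by
    have hdom : Integrable (fun z : EuclideanSpace ℝ (Fin d) × ℝ × ℝ => ‖k z.1‖)
      ((volume : Measure (EuclideanSpace ℝ (Fin d))).prod (ν.prod ν)) := hk.norm.comp_fst _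
    refine hdom.mono' (Measurable.aestronglyMeasurable ?_) (Eventually.of_forall fun z => ?_)
    · have h1 : Measurable fun z : EuclideanSpace ℝ (Fin d) × ℝ × ℝ => y z.2.1 - y' z.2.2 :=
        (hy.comp measurable_snd.fst).sub (hy'.comp measurable_snd.snd)
      have h2 : Measurable fun z : EuclideanSpace ℝ (Fin d) × ℝ × ℝ =>
          inner ℝ (y z.2.1 - y' z.2.2) ((2 * Real.pi) • z.1) :=
        h1.inner (Measurable.const_smul
          (g := fun z : EuclideanSpace ℝ (Fin d) × ℝ × ℝ => z.1) measurable_fst (2 * Real.pi))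
      have h3 : Measurable fun z : EuclideanSpace ℝ (Fin d) × ℝ × ℝ => k z.1 :=
        hkc.measurable.comp measurable_fst
      exact h3.mul (by fun_prop)
    · rw [norm_mul, Complex.norm_exp_ofReal_mul_I, mul_one]
  refine ⟨hint, ?_⟩
  have hint2 : Integrable (fun w : ℝ × ℝ => (F (y w.1 - y' w.2) : ℂ)) (ν.prod ν) := by
    simp_rw [hF]
    exact hint.integral_prod_right
  rw [integral_prod_symm _ hint]
  simp_rw [← hF]
  rw [integral_prod _ hint2]
  have hI : ∀ G : ℝ → ℝ, ∫ s in (0 : ℝ)..t, G s = ∫ s, G s ∂ν := fun G => by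
    rw [intervalIntegral.integral_of_le ht, integral_Icc_eq_integral_Ioc]
  simp_rw [hI]
  rw [← integral_complex_ofReal]
  refine integral_congr_ae (Eventually.of_forall fun s => ?_)
  exact integral_complex_ofReal.symm

/-! ### The even moments of the increments -/

theorem suffixSum_smul {E : Type*} [AddCommMonoid E] [Module ℝ E] {n : ℕ} (a : ℝ)
    (ξ : Fin n → E) (k : Fin n) : suffixSum (fun j => a • ξ j) k = a • suffixSum ξ k := by
  simp [suffixSum, Finset.smul_sum]

/-- Bound for the even moments of the increments of `ε ↦ α_{t,ε}`. -/
theorem exists_lintegral_mutualILT_sub_pow_le {d : ℕ} {β ρ : ℝ} (hβ : 0 < β) (hρ : 0 ≤ ρ)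
    (hρ1 : ρ ≤ 1) (hdβ : (d : ℝ) + 2 * ρ < 2 * β) {ψ : EuclideanSpace ℝ (Fin d) → ℝ}
    (f : SchwartzMap (EuclideanSpace ℝ (Fin d)) ℝ)
    {Ω : Type*} [MeasurableSpace Ω] {P : Measure Ω} [IsProbabilityMeasure P]
    {X X' : ℝ≥0 → Ω → EuclideanSpace ℝ (Fin d)}
    (hX : IsSymmetricStableProcess β ψ X P) (hX' : IsSymmetricStableProcess β ψ X' P)
    (hindep : IndepFun (fun ω t => X t ω) (fun ω t => X' t ω) P) :
    ∃ A : ℝ, 0 < A ∧ ∀ t ε ε' : ℝ, 0 < t → 0 < ε → 0 < ε' →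
      AEMeasurable (fun ω => mutualILT f X X' t ε ω - mutualILT f X X' t ε' ω) P ∧
      ∀ k : ℕ, 0 < k →
        ∫⁻ ω, ENNReal.ofReal
          ((mutualILT f X X' t ε ω - mutualILT f X X' t ε' ω) ^ (2 * k)) ∂P ≤
        ENNReal.ofReal ((A * (|ε - ε'| ^ ρ * t ^ (2 - (d + ρ) / β)) *
          ((2 * k : ℕ) : ℝ) ^ ((d + ρ) / β)) ^ (2 * k)) := by
  obtain ⟨h, C, hhc, hhi, hC, hrep, hholder⟩ := exists_fourier_representation_approxDelta f
  obtain ⟨Y, hYm, hYX⟩ := exists_measurable_version hX.measurable hX.cadlag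
  obtain ⟨Y', hYm', hYX'⟩ := exists_measurable_version hX'.measurable hX'.cadlag
  obtain ⟨c, _, hc, -, hbounds⟩ := hX.exponent.bounds
  -- Absorbs the 2π of the Fourier convention into the exponent.
  set κ : EuclideanSpace ℝ (Fin d) → ℝ := fun u => ψ ((2 * Real.pi) • u)
  have hκm : Measurable κ := (hX.exponent.continuous.comp (continuous_const_smul _)).measurable
  have hκ : ∀ u, c * (2 * Real.pi) ^ β * ‖u‖ ^ β ≤ κ u := by
    intro u
    refine le_trans (le_of_eq ?_) (hbounds ((2 * Real.pi) • u)).1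
    rw [norm_smul, Real.norm_of_nonneg (by positivity),
      Real.mul_rpow (by positivity) (norm_nonneg u), mul_assoc]
  obtain ⟨K, hK, hres⟩ := exists_lintegral_symmetrized_resolvent_le hβ hρ hdβ
    (by positivity : 0 < c * (2 * Real.pi) ^ β) hκm hκ
  set q : ℝ := (d + ρ) / β with hq
  -- exp 2 arises from one factor exp(lt) = exp(N) for each process; the `+ 1` ensures positivity,
  -- as `K` may vanish.
  refine ⟨C * Real.exp 2 * K + 1, by positivity, fun t ε ε' ht hε hε' => ?_⟩
  set δ : ℝ := |ε - ε'|
  set D : Ω → ℝ := fun ω => mutualILT f X X' t ε ω - mutualILT f X X' t ε' ω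
  set g : EuclideanSpace ℝ (Fin d) → ℂ := fun ξ => h (ε • ξ) - h (ε' • ξ)
  have hgc : Continuous g :=
    (hhc.comp (continuous_const_smul ε)).sub (hhc.comp (continuous_const_smul ε'))
  have hgi : Integrable g := (hhi.comp_smul hε.ne').sub (hhi.comp_smul hε'.ne')
  set m := (volume : Measure (EuclideanSpace ℝ (Fin d))).prod
          ((volume.restrict (Set.Icc 0 t)).prod (volume.restrict (Set.Icc 0 t)))
  have hD : ∀ᵐ ω ∂P, (D ω : ℂ) = ∫ z, g z.1 * Complex.exp
      ((inner ℝ (Y z.2.1 ω - Y' z.2.2 ω) ((2 * Real.pi) • z.1) : ℝ) * Complex.I) ∂m := by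
    filter_upwards [hYX, hYX'] with ω h1 h2
    have hy : Measurable fun s => Y s ω := hYm.comp measurable_prodMk_right
    have hy' : Measurable fun s => Y' s ω := hYm'.comp measurable_prodMk_right
    obtain ⟨i1, e1⟩ := integral_prod_character_eq (hhc.comp (continuous_const_smul ε))
      (hhi.comp_smul hε.ne') (hrep ε hε) hy hy' ht.le
    obtain ⟨i2, e2⟩ := integral_prod_character_eq (hhc.comp (continuous_const_smul ε'))
      (hhi.comp_smul hε'.ne') (hrep ε' hε') hy hy' ht.le
    simp only [h1, h2] at e1 e2 i1 i2 ⊢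
    simp only [D, mutualILT, g, Complex.ofReal_sub]
    rw [e1, e2, ← integral_sub i1 i2]
    refine integral_congr_ae (Eventually.of_forall fun z => ?_)
    simp only [Function.comp]
    ring
  have hmoment : ∀ N : ℕ, 0 < N → Integrable (fun ω => (D ω : ℂ) ^ N) P ∧
      ‖∫ ω, (D ω : ℂ) ^ N ∂P‖ₑ ≤ ENNReal.ofReal (((C * Real.exp 2 * K + 1) *
        (δ ^ ρ * t ^ (2 - q)) * (N : ℝ) ^ q) ^ N) := by
    intro N hN
    have hN0 : (0 : ℝ) < N := Nat.cast_pos.2 hN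
    -- This choice keeps exp(lt) geometric in N, while l^{q-2} = N^{q-2} t^{2-q} yields the power of
    -- t and a factor N^{-2N} that cancels (N!)² ≤ N^{2N}.
    set l : ℝ := N / t
    have hl : 0 < l := by positivity
    set a : ℝ := l ^ (1 / β)
    have ha : 0 < a := by positivity
    have hal : a ^ β = l := by
      rw [← Real.rpow_mul hl.le, one_div_mul_cancel hβ.ne', Real.rpow_one]
    have hlt : l * t = N := by simp only [l]; field_simp
    set S : (Fin N → EuclideanSpace ℝ (Fin d)) → ℝ≥0∞ := fun ξ =>
      ∑ π : Equiv.Perm (Fin N), ∏ k, ENNReal.ofReal (1 / (a ^ β + κ (suffixSum (ξ ∘ π) k)))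
    set b : (Fin N → EuclideanSpace ℝ (Fin d)) → ℝ≥0∞ := fun ξ =>
      ENNReal.ofReal (Real.exp (l * t)) * S ξ
    have hb : ∀ ξ, b ξ ≠ ∞ := fun ξ => ENNReal.mul_ne_top ENNReal.ofReal_ne_top
      (ENNReal.sum_ne_top.2 fun π _ => ENNReal.prod_ne_top fun k _ => ENNReal.ofReal_ne_top)
    have hproc : ∀ {Z : ℝ≥0 → Ω → EuclideanSpace ℝ (Fin d)},
        IsSymmetricStableProcess β ψ Z P → ∀ ξ,
        ∫⁻ s in {s : Fin N → ℝ | ∀ k, s k ∈ Set.Icc 0 t},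
          ‖∫ ω, Complex.exp ((∑ j, inner ℝ (Z (s j).toNNReal ω) ((2 * Real.pi) • ξ j) : ℝ) *
            Complex.I) ∂P‖ₑ ≤ b ξ := by
      intro Z hZ ξ
      refine (hZ.setLIntegral_enorm_integral_exp_le (fun j => (2 * Real.pi) • ξ j) hl
        ht.le).trans_eq ?_
      simp only [b, S, κ, hal, ← suffixSum_smul]
      rfl
    obtain ⟨hint, hle⟩ := integrable_and_enorm_integral_pow_le hX.measurable hX'.measurable
      hindep hYm hYm' hYX hYX' hgc hgi hb (hproc hX) (hproc hX')
    have hDN : (fun ω => (D ω : ℂ) ^ N) =ᵐ[P] fun ω => (∫ z, g z.1 * Complex.exp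
      ((inner ℝ (Y z.2.1 ω - Y' z.2.2 ω) ((2 * Real.pi) • z.1) : ℝ) * Complex.I) ∂m) ^ N := by
      filter_upwards [hD] with ω hω
      rw [hω]
    refine ⟨hint.congr hDN.symm, ?_⟩
    rw [integral_congr_ae hDN]
    refine hle.trans ?_
    have hg : ∀ ξ : Fin N → EuclideanSpace ℝ (Fin d), ∏ j, ‖g (ξ j)‖ₑ ≤
        ENNReal.ofReal ((C * δ ^ ρ) ^ N) * ∏ j, ENNReal.ofReal (‖ξ j‖ ^ ρ) := by
      intro ξ
      have : ENNReal.ofReal ((C * δ ^ ρ) ^ N) = ∏ _j : Fin N, ENNReal.ofReal (C * δ ^ ρ) := by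
        rw [Finset.prod_const, Finset.card_univ, Fintype.card_fin,
          ENNReal.ofReal_pow (by positivity)]
      rw [this, ← Finset.prod_mul_distrib]
      refine Finset.prod_le_prod' fun j _ => ?_
      rw [← ofReal_norm, ← ENNReal.ofReal_mul (by positivity)]
      refine ENNReal.ofReal_le_ofReal ((hholder ρ hρ hρ1 ε ε' (ξ j)).trans_eq ?_)
      rw [Real.mul_rpow (abs_nonneg _) (norm_nonneg _), mul_assoc]
    calc ∫⁻ ξ, (∏ j, ‖g (ξ j)‖ₑ) * b ξ ^ 2
        ≤ ∫⁻ ξ, (ENNReal.ofReal ((C * δ ^ ρ) ^ N) * ENNReal.ofReal (Real.exp (l * t)) ^ 2) *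
          ((∏ j, ENNReal.ofReal (‖ξ j‖ ^ ρ)) * S ξ ^ 2) := by
          refine lintegral_mono fun ξ => (mul_le_mul_left (hg ξ) _).trans_eq ?_
          simp only [b]
          ring
      _ = (ENNReal.ofReal ((C * δ ^ ρ) ^ N) * ENNReal.ofReal (Real.exp (l * t)) ^ 2) *
          ∫⁻ ξ, (∏ j, ENNReal.ofReal (‖ξ j‖ ^ ρ)) * S ξ ^ 2 :=
          lintegral_const_mul' _ _ (by finiteness)
      _ ≤ (ENNReal.ofReal ((C * δ ^ ρ) ^ N) * ENNReal.ofReal (Real.exp (l * t)) ^ 2) *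
          ENNReal.ofReal ((N.factorial : ℝ) ^ 2 * (K * a ^ (d + ρ - 2 * β)) ^ N) := by
          gcongr
          exact hres N a ha
      _ = ENNReal.ofReal ((C * δ ^ ρ) ^ N * Real.exp (l * t) ^ 2 *
          ((N.factorial : ℝ) ^ 2 * (K * a ^ (d + ρ - 2 * β)) ^ N)) := by
          rw [← ENNReal.ofReal_pow (by positivity), ← ENNReal.ofReal_mul (by positivity),
            ← ENNReal.ofReal_mul (by positivity)]
      _ ≤ _ := by
          refine ENNReal.ofReal_le_ofReal ?_
          have hfac : (N.factorial : ℝ) ≤ (N : ℝ) ^ N := by exact_mod_cast N.factorial_le_pow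
          have hexp : Real.exp (l * t) ^ 2 = Real.exp 2 ^ N := by
            rw [hlt, ← Real.exp_nat_mul, ← Real.exp_nat_mul]
            push_cast
            ring_nf
          have hpow : a ^ (d + ρ - 2 * β) = (N : ℝ) ^ q / (N : ℝ) ^ 2 * t ^ (2 - q) := by
            rw [← Real.rpow_mul hl.le, show 1 / β * (d + ρ - 2 * β) = q - 2 by
              rw [hq]; field_simp, Real.div_rpow hN0.le ht.le, Real.rpow_sub hN0,
              ← neg_sub q 2, Real.rpow_neg ht.le]
            norm_num [div_eq_mul_inv]
          rw [hexp, hpow]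
          have hT : 0 ≤ δ ^ ρ * t ^ (2 - q) * (N : ℝ) ^ q := by positivity
          calc (C * δ ^ ρ) ^ N * Real.exp 2 ^ N * ((N.factorial : ℝ) ^ 2 *
                (K * ((N : ℝ) ^ q / (N : ℝ) ^ 2 * t ^ (2 - q))) ^ N)
              ≤ (C * δ ^ ρ) ^ N * Real.exp 2 ^ N * (((N : ℝ) ^ N) ^ 2 *
                (K * ((N : ℝ) ^ q / (N : ℝ) ^ 2 * t ^ (2 - q))) ^ N) := by gcongr
            _ = (C * Real.exp 2 * K * (δ ^ ρ * t ^ (2 - q) * (N : ℝ) ^ q)) ^ N := by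
                rw [← pow_mul, mul_comm N 2, pow_mul, ← mul_pow, ← mul_pow, ← mul_pow]
                congr 1
                field_simp
            _ ≤ _ := by
                refine pow_le_pow_left₀ (by positivity) ?_ N
                nlinarith
  refine ⟨?_, fun k hk => ?_⟩
  · have h1 := (hmoment 1 one_pos).1.aestronglyMeasurable.aemeasurable
    simp only [pow_one] at h1
    exact Complex.measurable_re.comp_aemeasurable h1
  · obtain ⟨h1, h2⟩ := hmoment (2 * k) (by omega)
    have h3 : Integrable (fun ω => D ω ^ (2 * k)) P := by
      have := h1.re
      refine this.congr (Eventually.of_forall fun ω => ?_)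
      simp only [← Complex.ofReal_pow]
      exact Complex.ofReal_re _
    have hnn : ∀ ω, 0 ≤ D ω ^ (2 * k) := fun ω => (even_two_mul k).pow_nonneg _
    rw [← ofReal_integral_eq_lintegral_ofReal h3 (Eventually.of_forall hnn)]
    refine le_trans (le_of_eq ?_) h2
    simp_rw [← Complex.ofReal_pow]
    rw [integral_complex_ofReal, ← ofReal_norm, Complex.norm_real,
      Real.norm_of_nonneg (integral_nonneg hnn)]

/-! ### From moments to exponential moments -/

/-- Moments growing like `(A (2k)^{1/p})^{2k}` give a finite exponential moment of order `p`. -/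
theorem lintegral_exp_mul_rpow_le {Ω : Type*} [MeasurableSpace Ω] {P : Measure Ω}
    [IsProbabilityMeasure P] {Z : Ω → ℝ} (hZ : ∀ ω, 0 ≤ Z ω) (hZm : AEMeasurable Z P)
    {A p q θ : ℝ} (hA : 0 < A) (hp : 0 < p) (hp2 : p ≤ 2) (hqp : q * p = 1)
    (hmom : ∀ k : ℕ, 0 < k → ∫⁻ ω, ENNReal.ofReal (Z ω ^ (2 * k)) ∂P ≤
      ENNReal.ofReal ((A * ((2 * k : ℕ) : ℝ) ^ q) ^ (2 * k)))
    (hθ : 0 ≤ θ) (hθA : θ * A ^ p * 2 * Real.exp 1 ≤ 1 / 2) :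
    ∫⁻ ω, ENNReal.ofReal (Real.exp (θ * Z ω ^ p)) ∂P ≤ 4 := by
  have hterm : ∀ k : ℕ, ∫⁻ ω, ENNReal.ofReal ((θ * Z ω ^ p) ^ k / k.factorial) ∂P ≤
      ENNReal.ofReal (2 * (1 / 2) ^ k) := by
    intro k
    rcases Nat.eq_zero_or_pos k with rfl | hk
    · simp
    have hk0 : (0 : ℝ) < k := Nat.cast_pos.2 hk
    -- At this scale the 2k-th moment of Z/a is at most 1, and p ≤ 2 gives (Z/a)^{pk} ≤ 1 +
    -- (Z/a)^{2k}. Since a^p = 2k A^p, the bound k^k/k! ≤ e^k makes the series geometric.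
    set a : ℝ := A * ((2 * k : ℕ) : ℝ) ^ q
    have h2k : (0 : ℝ) < ((2 * k : ℕ) : ℝ) := Nat.cast_pos.2 (by omega)
    have ha : 0 < a := by positivity
    have hap : a ^ p = A ^ p * (2 * k) := by
      rw [Real.mul_rpow hA.le (by positivity), ← Real.rpow_mul h2k.le, hqp, Real.rpow_one]
      push_cast
      ring
    set c : ℝ := (θ * a ^ p) ^ k / k.factorial
    have hc0 : 0 ≤ c := by positivity
    have hc : c ≤ (1 / 2) ^ k := by
      have h1 := Real.pow_div_factorial_le_exp (k : ℝ) hk0.le k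
      have h2 : Real.exp (k : ℝ) = Real.exp 1 ^ k := by rw [← Real.exp_nat_mul, mul_one]
      calc c = (θ * A ^ p * 2) ^ k * ((k : ℝ) ^ k / k.factorial) := by
            simp only [c]
            rw [hap, ← mul_div_assoc, ← mul_pow]
            ring_nf
        _ ≤ (θ * A ^ p * 2) ^ k * Real.exp 1 ^ k := by
            rw [← h2]
            gcongr
        _ = (θ * A ^ p * 2 * Real.exp 1) ^ k := (mul_pow _ _ _).symm
        _ ≤ (1 / 2) ^ k := by gcongr
    have hpt : ∀ ω, (θ * Z ω ^ p) ^ k / k.factorial ≤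
        c + c * (1 / a ^ (2 * k)) * Z ω ^ (2 * k) := by
      intro ω
      have hy : 0 ≤ Z ω / a := div_nonneg (hZ ω) ha.le
      have hle : ((Z ω / a) ^ p) ^ k ≤ 1 + (Z ω / a) ^ (2 * k) := by
        rcases le_total (Z ω / a) 1 with h | h
        · have : ((Z ω / a) ^ p) ^ k ≤ 1 :=
            pow_le_one₀ (by positivity) (Real.rpow_le_one hy h hp.le)
          linarith [pow_nonneg hy (2 * k)]
        · have h1 : (Z ω / a) ^ p ≤ (Z ω / a) ^ 2 := by
            have := Real.rpow_le_rpow_of_exponent_le h hp2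
            rwa [Real.rpow_two] at this
          have : ((Z ω / a) ^ p) ^ k ≤ ((Z ω / a) ^ 2) ^ k := by gcongr
          rw [← pow_mul] at this
          linarith
      have hZa : Z ω ^ p = a ^ p * (Z ω / a) ^ p := by
        rw [← Real.mul_rpow ha.le hy, mul_div_cancel₀ _ ha.ne']
      calc (θ * Z ω ^ p) ^ k / k.factorial = c * ((Z ω / a) ^ p) ^ k := by
            simp only [c]
            rw [hZa]
            ring
        _ ≤ c * (1 + (Z ω / a) ^ (2 * k)) := by gcongr
        _ = _ := by rw [div_pow]; ring
    calc ∫⁻ ω, ENNReal.ofReal ((θ * Z ω ^ p) ^ k / k.factorial) ∂P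
        ≤ ∫⁻ ω, (ENNReal.ofReal c + ENNReal.ofReal (c * (1 / a ^ (2 * k))) *
            ENNReal.ofReal (Z ω ^ (2 * k))) ∂P := by
          refine lintegral_mono fun ω => (ENNReal.ofReal_le_ofReal (hpt ω)).trans ?_
          rw [← ENNReal.ofReal_mul (by positivity)]
          exact ENNReal.ofReal_add_le
      _ = ENNReal.ofReal c + ENNReal.ofReal (c * (1 / a ^ (2 * k))) *
            ∫⁻ ω, ENNReal.ofReal (Z ω ^ (2 * k)) ∂P := by
          rw [lintegral_add_left measurable_const, lintegral_const, measure_univ, mul_one,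
            lintegral_const_mul' _ _ ENNReal.ofReal_ne_top]
      _ ≤ ENNReal.ofReal c + ENNReal.ofReal (c * (1 / a ^ (2 * k))) *
            ENNReal.ofReal (a ^ (2 * k)) := by
          gcongr
          exact hmom k hk
      _ = ENNReal.ofReal (2 * c) := by
          rw [← ENNReal.ofReal_mul (by positivity), ← ENNReal.ofReal_add hc0 (by positivity)]
          congr 1
          field_simp
          ring
      _ ≤ _ := by gcongr
  have hexp : ∀ ω, ENNReal.ofReal (Real.exp (θ * Z ω ^ p)) =
      ∑' k : ℕ, ENNReal.ofReal ((θ * Z ω ^ p) ^ k / k.factorial) := by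
    intro ω
    have hnn : 0 ≤ θ * Z ω ^ p := mul_nonneg hθ (Real.rpow_nonneg (hZ ω) _)
    rw [← ENNReal.ofReal_tsum_of_nonneg (fun k => by positivity)
      (Real.summable_pow_div_factorial _), Real.exp_eq_exp_ℝ, NormedSpace.exp_eq_tsum_div]
  have hgeom : Summable fun k : ℕ => (2 : ℝ) * (1 / 2) ^ k :=
    summable_geometric_two.mul_left 2
  simp_rw [hexp]
  rw [lintegral_tsum fun k =>
    (((hZm.pow_const p).const_mul θ).pow_const k |>.div_const _).ennreal_ofReal]
  calc ∑' k : ℕ, ∫⁻ ω, ENNReal.ofReal ((θ * Z ω ^ p) ^ k / k.factorial) ∂P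
      ≤ ∑' k : ℕ, ENNReal.ofReal (2 * (1 / 2) ^ k) := ENNReal.tsum_le_tsum hterm
    _ = ENNReal.ofReal 4 := by
        rw [← ENNReal.ofReal_tsum_of_nonneg (fun k => by positivity) hgeom, tsum_mul_left,
          tsum_geometric_two]
        norm_num
    _ = 4 := by norm_num

/-- Convexity of exp between 0 and θ₀y bounds exp(θy) by 1 + (|θ|/θ₀) exp(θ₀y). The result depends
on `y` only through the bound at θ₀, hence is uniform over the supremum. -/
theorem lintegral_exp_le_one_add {Ω : Type*} [MeasurableSpace Ω] {P : Measure Ω}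
    [IsProbabilityMeasure P] {y : Ω → ℝ} (hy : ∀ ω, 0 ≤ y ω) {θ₀ θ : ℝ} (hθ₀ : 0 < θ₀)
    (h : ∫⁻ ω, ENNReal.ofReal (Real.exp (θ₀ * y ω)) ∂P ≤ 4) (hθ : |θ| ≤ θ₀) :
    ∫⁻ ω, ENNReal.ofReal (Real.exp (θ * y ω)) ∂P ≤ 1 + ENNReal.ofReal (4 * |θ| / θ₀) := by
  set s : ℝ := |θ| / θ₀ with hs
  have hs0 : 0 ≤ s := by positivity
  have hs1 : s ≤ 1 := (div_le_one hθ₀).2 hθ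
  have hpt : ∀ ω, Real.exp (θ * y ω) ≤ 1 + s * Real.exp (θ₀ * y ω) := by
    intro ω
    have h1 := convexOn_exp.2 (Set.mem_univ 0) (Set.mem_univ (θ₀ * y ω)) (sub_nonneg.2 hs1) hs0
      (by ring)
    simp only [smul_eq_mul, mul_zero, zero_add, Real.exp_zero, mul_one] at h1
    have h2 : θ * y ω ≤ s * (θ₀ * y ω) := by
      have : s * (θ₀ * y ω) = |θ| * y ω := by rw [hs]; field_simp
      rw [this]
      exact mul_le_mul_of_nonneg_right (le_abs_self θ) (hy ω)
    linarith [Real.exp_le_exp.2 h2]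
  calc ∫⁻ ω, ENNReal.ofReal (Real.exp (θ * y ω)) ∂P
      ≤ ∫⁻ ω, (1 + ENNReal.ofReal s * ENNReal.ofReal (Real.exp (θ₀ * y ω))) ∂P := by
        refine lintegral_mono fun ω => (ENNReal.ofReal_le_ofReal (hpt ω)).trans_eq ?_
        rw [ENNReal.ofReal_add zero_le_one (by positivity), ENNReal.ofReal_mul hs0,
          ENNReal.ofReal_one]
    _ = 1 + ENNReal.ofReal s * ∫⁻ ω, ENNReal.ofReal (Real.exp (θ₀ * y ω)) ∂P := by
        rw [lintegral_add_left measurable_const, lintegral_const, measure_univ, mul_one,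
          lintegral_const_mul' _ _ ENNReal.ofReal_ne_top]
    _ ≤ 1 + ENNReal.ofReal s * 4 := by gcongr
    _ = _ := by
        rw [show (4 : ℝ≥0∞) = ENNReal.ofReal 4 by norm_num, ← ENNReal.ofReal_mul hs0]
        congr 2
        rw [hs]
        ring

/-- From exp(x) ≥ 1 + x at both signs; an upper bound at -θ thereby becomes a lower bound at θ. -/
theorem two_le_lintegral_exp_add_lintegral_exp_neg {Ω : Type*} [MeasurableSpace Ω]
    {P : Measure Ω} [IsProbabilityMeasure P] {y : Ω → ℝ} (hy : AEMeasurable y P) (θ : ℝ) :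
    2 ≤ ∫⁻ ω, ENNReal.ofReal (Real.exp (θ * y ω)) ∂P +
      ∫⁻ ω, ENNReal.ofReal (Real.exp (-θ * y ω)) ∂P := by
  have hm : AEMeasurable (fun ω => ENNReal.ofReal (Real.exp (θ * y ω))) P :=
    (Real.measurable_exp.comp_aemeasurable (hy.const_mul θ)).ennreal_ofReal
  rw [← lintegral_add_left' hm]
  calc (2 : ℝ≥0∞) = ∫⁻ _, 2 ∂P := by simp
    _ ≤ _ := by
      refine lintegral_mono fun ω => ?_
      rw [← ENNReal.ofReal_add (Real.exp_pos _).le (Real.exp_pos _).le]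
      refine ENNReal.le_ofReal_iff_toReal_le (by simp) (by positivity) |>.2 ?_
      have h1 := Real.add_one_le_exp (θ * y ω)
      have h2 := Real.add_one_le_exp (-θ * y ω)
      rw [ENNReal.toReal_ofNat]
      linarith

/-! ### Assembly of the uniform bound and the limit -/

theorem theorem5 {d : ℕ} {β : ℝ} (hβ : (d : ℝ) / 2 < β) (hβd : β ≤ d)
    (ψ : EuclideanSpace ℝ (Fin d) → ℝ)
    (f : SchwartzMap (EuclideanSpace ℝ (Fin d)) ℝ) (hf : IsMollifier f)
    {Ω : Type*} [MeasurableSpace Ω] (P : Measure Ω) [IsProbabilityMeasure P]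
    (X X' : ℝ≥0 → Ω → EuclideanSpace ℝ (Fin d))
    (hX : IsSymmetricStableProcess β ψ X P) (hX' : IsSymmetricStableProcess β ψ X' P)
    (hindep : IndepFun (fun ω t => X t ω) (fun ω t => X' t ω) P) :
    ∃ ρ₀ : ℝ, 0 < ρ₀ ∧ ∀ ρ : ℝ, 0 < ρ → ρ < ρ₀ →
      (∃ θ : ℝ, 0 < θ ∧ supExpMoment P β f X X' ρ θ < ∞) ∧
      Tendsto (fun θ : ℝ => supExpMoment P β f X X' ρ θ) (𝓝[≠] 0) (𝓝 1) := by
  have hβ0 : 0 < β := lt_of_le_of_lt (by positivity) hβ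
  -- ρ ≤ 1 is required by the Hölder bound on the amplitudes, and d + 2ρ < 2β by convergence of the
  -- frequency integral.
  refine ⟨min 1 ((2 * β - d) / 2), lt_min one_pos (by linarith), fun ρ hρ hρ₀ => ?_⟩
  have hρ1 : ρ ≤ 1 := (hρ₀.trans_le (min_le_left _ _)).le
  have hρ2 : (d : ℝ) + 2 * ρ < 2 * β := by linarith [hρ₀.trans_le (min_le_right _ _)]
  obtain ⟨A, hA, hmom⟩ :=
    exists_lintegral_mutualILT_sub_pow_le hβ0 hρ.le hρ1 hρ2 f hX hX' hindep
  have hdρ : 0 < (d : ℝ) + ρ := by positivity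
  set p : ℝ := β / (d + ρ) with hp
  set q : ℝ := (d + ρ) / β with hq
  have hp0 : 0 < p := div_pos hβ0 hdρ
  have hp2 : p ≤ 2 := by rw [hp, div_le_iff₀ hdρ]; linarith
  have hqp : q * p = 1 := by rw [hp, hq]; field_simp
  -- Gives θ₀ · A^p · 2e = 1/2 exactly, the ratio of the geometric series.
  set θ₀ : ℝ := 1 / (4 * A ^ p * Real.exp 1) with hθ₀
  have hθ₀0 : 0 < θ₀ := by positivity
  set y : ℝ → ℝ → ℝ → Ω → ℝ := fun ε ε' t ω =>
    |(mutualILT f X X' t ε ω - mutualILT f X X' t ε' ω) /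
      (|ε - ε'| ^ ρ * t ^ (2 - q))| ^ p
  have hy0 : ∀ ε ε' t ω, 0 ≤ y ε ε' t ω := fun ε ε' t ω => Real.rpow_nonneg (abs_nonneg _) _
  have hym : ∀ ε ε' t : ℝ, 0 < ε ∧ 0 < ε' ∧ ε ≠ ε' ∧ 0 < t → AEMeasurable (y ε ε' t) P := by
    rintro ε ε' t ⟨h1, h2, -, h4⟩
    exact (((hmom t ε ε' h4 h1 h2).1.div_const _).abs).pow_const p
  have hbase : ∀ ε ε' t : ℝ, 0 < ε ∧ 0 < ε' ∧ ε ≠ ε' ∧ 0 < t →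
      ∫⁻ ω, ENNReal.ofReal (Real.exp (θ₀ * y ε ε' t ω)) ∂P ≤ 4 := by
    rintro ε ε' t ⟨h1, h2, h3, h4⟩
    obtain ⟨hm, hk⟩ := hmom t ε ε' h4 h1 h2
    set T : ℝ := |ε - ε'| ^ ρ * t ^ (2 - q)
    have hT : 0 < T := by
      have := abs_pos.2 (sub_ne_zero.2 h3)
      positivity
    refine lintegral_exp_mul_rpow_le (fun ω => abs_nonneg _) (hm.div_const _).abs hA hp0 hp2 hqp
      (fun k hk0 => ?_) hθ₀0.le ?_
    · have hpow : ∀ ω, |(mutualILT f X X' t ε ω - mutualILT f X X' t ε' ω) / T| ^ (2 * k) =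
          (1 / T ^ (2 * k)) *
            (mutualILT f X X' t ε ω - mutualILT f X X' t ε' ω) ^ (2 * k) := by
        intro ω
        rw [(even_two_mul k).pow_abs, div_pow]
        ring
      change ∫⁻ ω, ENNReal.ofReal (|(mutualILT f X X' t ε ω -
        mutualILT f X X' t ε' ω) / T| ^ (2 * k)) ∂P ≤ _
      simp_rw [hpow, ENNReal.ofReal_mul (by positivity : 0 ≤ 1 / T ^ (2 * k))]
      rw [lintegral_const_mul' _ _ ENNReal.ofReal_ne_top]
      refine (mul_le_mul_right (hk k hk0) _).trans_eq ?_
      rw [← ENNReal.ofReal_mul (by positivity)]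
      congr 1
      rw [mul_right_comm, mul_comm _ T, mul_pow T, one_div,
        inv_mul_cancel_left₀ (pow_ne_zero _ hT.ne')]
    · rw [hθ₀]
      apply le_of_eq
      field_simp
      norm_num
  have hupper : ∀ θ : ℝ, |θ| ≤ θ₀ →
      supExpMoment P β f X X' ρ θ ≤ 1 + ENNReal.ofReal (4 * |θ| / θ₀) := fun θ hθ =>
    iSup_le fun ε => iSup_le fun ε' => iSup_le fun t => iSup_le fun h =>
      lintegral_exp_le_one_add (hy0 ε ε' t) hθ₀0 (hbase ε ε' t h) hθ
  have hlower : ∀ θ : ℝ, |θ| ≤ θ₀ →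
      2 - (1 + ENNReal.ofReal (4 * |θ| / θ₀)) ≤ supExpMoment P β f X X' ρ θ := by
    intro θ hθ
    -- Any single admissible triple bounds the supremum from below; here ε = 1, ε' = 2, t = 1.
    have h12 : (0 : ℝ) < 1 ∧ (0 : ℝ) < 2 ∧ (1 : ℝ) ≠ 2 ∧ (0 : ℝ) < 1 := by norm_num
    have h1 := two_le_lintegral_exp_add_lintegral_exp_neg (hym 1 2 1 h12) θ
    have h2 := lintegral_exp_le_one_add (hy0 1 2 1) hθ₀0 (hbase 1 2 1 h12)
      ((abs_neg θ).trans_le hθ)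
    rw [abs_neg] at h2
    have h3 : ∫⁻ ω, ENNReal.ofReal (Real.exp (θ * y 1 2 1 ω)) ∂P ≤
        supExpMoment P β f X X' ρ θ :=
      le_iSup_of_le 1 (le_iSup_of_le 2 (le_iSup_of_le 1 (le_iSup_of_le h12 le_rfl)))
    exact tsub_le_iff_right.2 (h1.trans (add_le_add h3 h2))
  refine ⟨⟨θ₀, hθ₀0, (hupper θ₀ (abs_of_pos hθ₀0).le).trans_lt (by finiteness)⟩, ?_⟩
  have hsmall : ∀ᶠ θ : ℝ in 𝓝[≠] 0, |θ| ≤ θ₀ := by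
    refine nhdsWithin_le_nhds ?_
    filter_upwards [Metric.closedBall_mem_nhds (0 : ℝ) hθ₀0] with θ hθ
    simpa using hθ
  have hlim : Tendsto (fun θ : ℝ => 1 + ENNReal.ofReal (4 * |θ| / θ₀)) (𝓝[≠] 0) (𝓝 1) := by
    have hc : Continuous fun θ : ℝ => 1 + ENNReal.ofReal (4 * |θ| / θ₀) :=
      continuous_const.add (ENNReal.continuous_ofReal.comp (by fun_prop))
    have := hc.tendsto 0
    simp only [abs_zero, mul_zero, zero_div, ENNReal.ofReal_zero, add_zero] at this
    exact this.mono_left nhdsWithin_le_nhds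
  have hlim' : Tendsto (fun θ : ℝ => 2 - (1 + ENNReal.ofReal (4 * |θ| / θ₀))) (𝓝[≠] 0)
      (𝓝 1) := by
    have := ENNReal.Tendsto.sub (tendsto_const_nhds (x := (2 : ℝ≥0∞))) hlim
      (Or.inl ENNReal.ofNat_ne_top)
    rwa [show (2 : ℝ≥0∞) - 1 = 1 by
      rw [← one_add_one_eq_two, ENNReal.add_sub_cancel_right ENNReal.one_ne_top]] at this
  exact tendsto_of_tendsto_of_tendsto_of_le_of_le' hlim' hlim
    (hsmall.mono fun θ hθ => hlower θ hθ) (hsmall.mono fun θ hθ => hupper θ hθ)
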